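/- Let $Y_{jt}=\mu_j+u_{jt}$, $t=1,2,\dots$, $j=1,2$, where $E u_{jt}=0$, $\mathrm{Var}(u_{jt})=\sigma_j^2<\infty$, and the two (possibly serially dependent) error series $\{u_{1t}\}$ and $\{u_{2t}\}$ are independent of each other. Let $K_1,K_2\ge 1$ be fixed integers and $K=\max(K_1,K_2)$. Assume: (1) $\phi_1,\dots,\phi_K$ are piecewise monotonic, continuously differentiable functions on $[0,1]$ that are orthonormal in $L_2[0,1]$ and satisfy $\int_0^1\phi_\ell(x)\,dx=0$ for every $\ell$; (2) with $u_t=(u_{1t},u_{2t})'$ and constants $\Omega_1,\Omega_2>0$ (the long-run variances of the two series), the functional central limit theorem $$\frac1{\sqrt T}\sum_{t=1}^{\lfloor rT\rfloor}u_t\ \to^d\ \begin{pmatrix}\sqrt{\Omega_1}&0\\0&\sqrt{\Omega_2}\end{pmatrix}W_2(r),\qquad r\in[0,1],$$ holds as $T\to\infty$ in the Skorokhod space of càdlàg $\mathbb R^2$-valued functions on $[0,1]$, where $W_2$ is a two-dimensional standard Brownian motion; (3) $\Omega_1=\Omega_2$. For samples $Y_{j1},\dots,Y_{jT_j}$ put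 $\bar Y_j=T_j^{-1}\sum_{t=1}^{T_j}Y_{jt}$, $$\hat\Omega_j=\frac1{K_j}\sum_{\ell=1}^{K_j}\Big(\frac1{\sqrt{T_j}}\sum_{t=1}^{T_j}\phi_\ell\big(t/T_j\big)\,(Y_{jt}-\bar Y_j)\Big)^2,\qquad s_{p,\mathrm{HAR}}=\sqrt{\frac{K_1\hat\Omega_1+K_2\hat\Omega_2}{K_1+K_2}},$$ $$t_{0,\mathrm{HAR}}=\frac{\bar Y_1-\bar Y_2}{s_{p,\mathrm{HAR}}\sqrt{1/T_1+1/T_2}}.$$ Then, under $H_0:\mu_1=\mu_2$, as $T_1,T_2\to\infty$ (with no restriction on their relative rates) with $K_1,K_2$ fixed, $t_{0,\mathrm{HAR}}$ converges in distribution to Student's $t$-distribution with $K_1+K_2$ degrees of freedom. -/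

import Mathlib

open MeasureTheory ProbabilityTheory Filter Topology
open scoped NNReal

noncomputable section

namespace SeriesHAR

/-! ### The Skorokhod space of càdlàg functions on the unit interval -/

/-- Right-continuous functions with left limits on `[0,1]`, with values in `E`. -/
structure Cadlag (E : Type*) [TopologicalSpace E] where
  toFun : unitInterval → E
  right_continuous : ∀ r, ContinuousWithinAt toFun (Set.Ici r) r
  left_limits : ∀ r, ∃ l, Tendsto toFun (𝓝[<] r) (𝓝 l)

instance {E : Type*} [TopologicalSpace E] : CoeFun (Cadlag E) (fun _ => unitInterval → E) :=
  ⟨Cadlag.toFun⟩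

/-- The open ball of radius `ε` around `x` for the Skorokhod metric
`d(x, y) = inf_τ max (sup_r |τ r - r|, sup_r |x r - y (τ r)|)`, where `τ` ranges over the
increasing bijections of `[0,1]`. -/
def skorokhodBall {E : Type*} [MetricSpace E] (x : Cadlag E) (ε : ℝ) : Set (Cadlag E) :=
  {y | ∃ (τ : unitInterval ≃o unitInterval) (δ : ℝ), δ < ε ∧
    (∀ r, dist (τ r) r ≤ δ) ∧ (∀ r, dist (x r) (y (τ r)) ≤ δ)}

/-- The Skorokhod (J1) topology. -/
instance {E : Type*} [MetricSpace E] : TopologicalSpace (Cadlag E) :=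
  TopologicalSpace.generateFrom {s | ∃ (x : Cadlag E) (ε : ℝ), s = skorokhodBall x ε}

instance {E : Type*} [MetricSpace E] : MeasurableSpace (Cadlag E) := borel _

instance {E : Type*} [MetricSpace E] : BorelSpace (Cadlag E) := ⟨rfl⟩

/-! ### Partial sum processes and the functional central limit theorem -/

lemma floor_eventually_const_right (T : ℕ) (r : unitInterval) :
    ∀ᶠ s : unitInterval in 𝓝[≥] r, ⌊(s : ℝ) * T⌋₊ = ⌊(r : ℝ) * T⌋₊ := by
  have h0 : 0 ≤ (r : ℝ) * T := mul_nonneg r.2.1 (Nat.cast_nonneg T)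
  have hc : Continuous fun s : unitInterval => (s : ℝ) * T := by fun_prop
  have h1 : ∀ᶠ s : unitInterval in 𝓝[≥] r, (s : ℝ) * T < (⌊(r : ℝ) * T⌋₊ : ℝ) + 1 :=
    nhdsWithin_le_nhds (hc.continuousAt.eventually (Iio_mem_nhds (Nat.lt_floor_add_one _)))
  filter_upwards [h1, self_mem_nhdsWithin] with s hs hrs
  have hle : (r : ℝ) * T ≤ (s : ℝ) * T :=
    mul_le_mul_of_nonneg_right (by exact_mod_cast hrs) (Nat.cast_nonneg T)
  rw [Nat.floor_eq_iff (h0.trans hle)]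
  exact ⟨(Nat.floor_le h0).trans hle, hs⟩

lemma floor_eventually_const_left (T : ℕ) (r : unitInterval) :
    ∃ k : ℕ, ∀ᶠ s : unitInterval in 𝓝[<] r, ⌊(s : ℝ) * T⌋₊ = k := by
  have hc : Continuous fun s : unitInterval => (s : ℝ) * T := by fun_prop
  rcases Nat.eq_zero_or_pos T with rfl | hT
  · exact ⟨0, by simp⟩
  have hT' : (0 : ℝ) < T := by exact_mod_cast hT
  have h1 : ∀ᶠ s : unitInterval in 𝓝[<] r, ((⌈(r : ℝ) * T⌉₊ : ℝ) - 1) < (s : ℝ) * T := by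
    refine nhdsWithin_le_nhds (hc.continuousAt.eventually (Ioi_mem_nhds ?_))
    have := Nat.ceil_lt_add_one (mul_nonneg r.2.1 hT'.le)
    linarith
  refine ⟨⌈(r : ℝ) * T⌉₊ - 1, ?_⟩
  filter_upwards [h1, self_mem_nhdsWithin] with s hs hsr
  have hlt : (s : ℝ) * T < (r : ℝ) * T :=
    mul_lt_mul_of_pos_right (by exact_mod_cast hsr) hT'
  have h0 : 0 ≤ (s : ℝ) * T := mul_nonneg s.2.1 hT'.le
  have hpos : 1 ≤ ⌈(r : ℝ) * T⌉₊ := Nat.ceil_pos.2 (h0.trans_lt hlt)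
  rw [Nat.floor_eq_iff h0]
  push_cast [Nat.cast_sub hpos]
  exact ⟨hs.le, by linarith [Nat.le_ceil ((r : ℝ) * T)]⟩

/-- The partial sum process `r ↦ T^{-1/2} ∑_{t=1}^{⌊rT⌋} v_t`, an element of the
Skorokhod space. -/
def partialSumProcess {E : Type*} [NormedAddCommGroup E] [NormedSpace ℝ E]
    (v : ℕ → E) (T : ℕ) : Cadlag E where
  toFun r := (1 / √(T : ℝ)) • ∑ t ∈ Finset.Icc 1 ⌊(r : ℝ) * T⌋₊, v t
  right_continuous r := by
    refine Tendsto.congr' ?_ tendsto_const_nhds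
    filter_upwards [floor_eventually_const_right T r] with s hs
    rw [hs]
  left_limits r := by
    obtain ⟨k, hk⟩ := floor_eventually_const_left T r
    refine ⟨(1 / √(T : ℝ)) • ∑ t ∈ Finset.Icc 1 k, v t, Tendsto.congr' ?_ tendsto_const_nhds⟩
    filter_upwards [hk] with s hs
    rw [hs]

/-- A two-dimensional standard Brownian motion: two independent real Brownian motions. -/
structure IsStandardBrownian₂ {Ω' : Type*} [MeasurableSpace Ω']
    (W : Fin 2 → ℝ≥0 → Ω' → ℝ) (P' : Measure Ω') : Prop where
  isBrownian : ∀ j, IsBrownianReal (W j) P'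
  indep : iIndepFun (fun j ω r => W j r ω) P'

/-- The functional central limit theorem for the bivariate errors `u_t = (u_{1t}, u_{2t})`:
in the Skorokhod space of `ℝ²`-valued functions on `[0,1]`, the partial sum process converges in
distribution to `diag(√lrv₁, √lrv₂) W`. -/
def FunctionalCLT {Ω Ω' : Type*} [MeasurableSpace Ω] [MeasurableSpace Ω']
    (P : Measure Ω) [IsProbabilityMeasure P] (P' : Measure Ω') [IsProbabilityMeasure P']
    (u : Fin 2 → ℕ → Ω → ℝ) (lrv : Fin 2 → ℝ) (W : Fin 2 → ℝ≥0 → Ω' → ℝ) : Prop :=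
  ∃ Z : Ω' → Cadlag (Fin 2 → ℝ),
    (∀ᵐ ω ∂P', ∀ (r : unitInterval) (j : Fin 2), Z ω r j = √(lrv j) * W j ⟨(r : ℝ), r.2.1⟩ ω) ∧
    TendstoInDistribution
      (fun (T : ℕ) (ω : Ω) => partialSumProcess (fun t => fun j => u j t ω) T)
      atTop Z (fun _ => P) P'

/-! ### The model and the basis functions -/

/-- The two-sample model `Y_{jt} = μ_j + u_{jt}`, `u_{jt} ∼ (0, σ_j²)`, `t = 1, 2, …`, in which
the two error series are independent of each other (each may be serially dependent). -/
structure TwoSampleModel {Ω : Type*} [MeasurableSpace Ω] (P : Measure Ω)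
    (Y u : Fin 2 → ℕ → Ω → ℝ) (μ σ : Fin 2 → ℝ) : Prop where
  obs : ∀ j t ω, Y j t ω = μ j + u j t ω
  memLp : ∀ j t, 1 ≤ t → MemLp (u j t) 2 P
  mean : ∀ j t, 1 ≤ t → ∫ ω, u j t ω ∂P = 0
  var : ∀ j t, 1 ≤ t → Var[u j t; P] = σ j ^ 2
  indep : IndepFun (fun ω (t : ℕ) => u 0 (t + 1) ω) (fun ω (t : ℕ) => u 1 (t + 1) ω) P

/-- There is a finite partition of `[0,1]` into intervals on each of which `f` is monotone. -/
def PiecewiseMonotone (f : ℝ → ℝ) : Prop :=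
  ∃ (n : ℕ) (a : ℕ → ℝ), Monotone a ∧ a 0 = 0 ∧ a n = 1 ∧
    ∀ i < n, MonotoneOn f (Set.Icc (a i) (a (i + 1))) ∨
      AntitoneOn f (Set.Icc (a i) (a (i + 1)))

/-- `φ_1, …, φ_K` are piecewise monotonic, continuously differentiable, orthonormal in
`L²[0,1]`, and have mean zero. -/
structure IsBasisFamily (φ : ℕ → ℝ → ℝ) (K : ℕ) : Prop where
  piecewiseMonotone : ∀ l ∈ Finset.Icc 1 K, PiecewiseMonotone (φ l)
  contDiffOn : ∀ l ∈ Finset.Icc 1 K, ContDiffOn ℝ 1 (φ l) (Set.Icc 0 1)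
  orthonormal : ∀ k ∈ Finset.Icc 1 K, ∀ l ∈ Finset.Icc 1 K,
    ∫ x in (0 : ℝ)..1, φ k x * φ l x = if k = l then 1 else 0
  mean_zero : ∀ l ∈ Finset.Icc 1 K, ∫ x in (0 : ℝ)..1, φ l x = 0

/-! ### The statistic -/

/-- The sample mean of `y_1, …, y_T`. -/
def sampleMean (y : ℕ → ℝ) (T : ℕ) : ℝ := (1 / (T : ℝ)) * ∑ t ∈ Finset.Icc 1 T, y t

/-- The projection coefficient `T^{-1/2} ∑_{t=1}^T f(t/T) (y_t - ȳ)`. -/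
def projCoeff (f : ℝ → ℝ) (y : ℕ → ℝ) (T : ℕ) : ℝ :=
  (1 / √(T : ℝ)) * ∑ t ∈ Finset.Icc 1 T, f ((t : ℝ) / T) * (y t - sampleMean y T)

/-- The series HAR estimator of the long-run variance with `K` basis functions. -/
def seriesLRV (φ : ℕ → ℝ → ℝ) (K : ℕ) (y : ℕ → ℝ) (T : ℕ) : ℝ :=
  (1 / (K : ℝ)) * ∑ l ∈ Finset.Icc 1 K, projCoeff (φ l) y T ^ 2

/-- The pooled series HAR scale estimator. -/
def pooledScale (φ : ℕ → ℝ → ℝ) (K₁ K₂ : ℕ) (y₁ y₂ : ℕ → ℝ) (T₁ T₂ : ℕ) : ℝ :=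
  √((K₁ * seriesLRV φ K₁ y₁ T₁ + K₂ * seriesLRV φ K₂ y₂ T₂) / ((K₁ : ℝ) + K₂))

/-- The pooled series HAR two-sample `t`-statistic. -/
def tHAR (φ : ℕ → ℝ → ℝ) (K₁ K₂ : ℕ) (y₁ y₂ : ℕ → ℝ) (T₁ T₂ : ℕ) : ℝ :=
  (sampleMean y₁ T₁ - sampleMean y₂ T₂) /
    (pooledScale φ K₁ K₂ y₁ y₂ T₁ T₂ * √(1 / (T₁ : ℝ) + 1 / (T₂ : ℝ)))

/-! ### Student's t-distribution -/

/-- The `χ²`-distribution with `ν` degrees of freedom: the law of the sum of squares of `ν`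
independent standard normal variables. -/
def chiSquared (ν : ℕ) : Measure ℝ :=
  (Measure.pi fun _ : Fin ν => gaussianReal 0 1).map fun x => ∑ i, x i ^ 2

instance (ν : ℕ) : IsProbabilityMeasure (chiSquared ν) :=
  Measure.isProbabilityMeasure_map (Measurable.aemeasurable (by fun_prop))

/-- Student's `t`-distribution with `ν` degrees of freedom: the law of `Z / √(V / ν)` for
independent `Z ∼ N(0,1)` and `V ∼ χ²(ν)`. -/
def studentT (ν : ℕ) : Measure ℝ :=
  ((gaussianReal 0 1).prod (chiSquared ν)).map fun p => p.1 / √(p.2 / ν)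

instance (ν : ℕ) : IsProbabilityMeasure (studentT ν) :=
  Measure.isProbabilityMeasure_map (Measurable.aemeasurable (by fun_prop))

end SeriesHAR

end

open SeriesHAR

/-! Let S_j be the score vector T_j^{-1/2} ∑ (1, φ_1(t/T_j), …, φ_{K_j}(t/T_j)) u_{jt}. Summation by
parts turns S_j, exactly, into a Skorokhod-continuous functional of the partial sum process
(`scoreFunctional_partialSumProcess`, `continuous_scoreFunctional`). By the functional CLT, a linear
combination of its entries tends to √lrv times the Wiener integral of the same combination of 1,
φ_1, …, φ_{K_j}. Mean zero and orthonormality make 1, φ_1, … an orthonormal system, so S_j is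
asymptotically N(0, lrv_j I) (`tendsto_charFun_scoreVector`).

Under the null the statistic is exactly `tRatio` of one vector (`tHAR_const_add`): first the
difference of the leading scores with weights a, b satisfying a² + b² = 1, then the demeaned scores.
Demeaning subtracts a grid mean of φ_l times the leading score, and grid means tend to ∫ φ_l = 0.
The samples have different lengths, so the functional CLT is applied to each coordinate separately,
and independence of the series multiplies the characteristic functions.

As the long-run variances agree, the limit law is N(0, lrv · I) whatever (a, b) is. The weights stay
in a compact square, so passing to subsequences removes any condition on T_1/T_2
(`tendsto_law_sampleJointScore`). Continuous mapping off the null set where the denominator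
vanishes, with scale invariance of the ratio, gives Student's law. -/

namespace SeriesHAR

/-! ### Summation by parts and Riemann sums -/

/-- On `[0,1]`, the function `ψ` is differentiable with continuous derivative `g`. -/
structure HasContDerivOn (ψ g : ℝ → ℝ) : Prop where
  cont : ContinuousOn g (Set.Icc 0 1)
  deriv : ∀ r ∈ Set.Icc (0 : ℝ) 1, HasDerivWithinAt ψ (g r) (Set.Icc 0 1) r

namespace HasContDerivOn

variable {ψ g χ h : ℝ → ℝ}

lemma continuousOn (hψ : HasContDerivOn ψ g) : ContinuousOn ψ (Set.Icc 0 1) :=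
  fun r hr => (hψ.deriv r hr).continuousWithinAt

lemma intervalIntegrable (hψ : HasContDerivOn ψ g) {a b : ℝ} (ha : a ∈ Set.Icc (0 : ℝ) 1)
    (hb : b ∈ Set.Icc (0 : ℝ) 1) : IntervalIntegrable g volume a b :=
  (hψ.cont.mono (Set.uIcc_subset_Icc ha hb)).intervalIntegrable

lemma integral_eq_sub (hψ : HasContDerivOn ψ g) {a b : ℝ} (ha : a ∈ Set.Icc (0 : ℝ) 1)
    (hb : b ∈ Set.Icc (0 : ℝ) 1) (hab : a ≤ b) : ∫ r in a..b, g r = ψ b - ψ a := by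
  refine intervalIntegral.integral_eq_sub_of_hasDerivAt_of_le hab
    (hψ.continuousOn.mono (Set.Icc_subset_Icc ha.1 hb.2)) (fun r hr => ?_)
    (hψ.intervalIntegrable ha hb)
  have h0 : 0 < r := ha.1.trans_lt hr.1
  have h1 : r < 1 := hr.2.trans_le hb.2
  exact (hψ.deriv r ⟨h0.le, h1.le⟩).hasDerivAt (Icc_mem_nhds h0 h1)

lemma mul (hψ : HasContDerivOn ψ g) (hχ : HasContDerivOn χ h) :
    HasContDerivOn (fun r => ψ r * χ r) (fun r => g r * χ r + ψ r * h r) where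
  cont := (hψ.cont.mul hχ.continuousOn).add (hψ.continuousOn.mul hχ.cont)
  deriv r hr := (hψ.deriv r hr).mul (hχ.deriv r hr)

lemma id : HasContDerivOn (fun r => r) (fun _ => 1) where
  cont := continuousOn_const
  deriv r _ := hasDerivWithinAt_id r _

lemma of_contDiffOn (hψ : ContDiffOn ℝ 1 ψ (Set.Icc 0 1)) :
    HasContDerivOn ψ (derivWithin ψ (Set.Icc 0 1)) where
  cont := hψ.continuousOn_derivWithin (uniqueDiffOn_Icc zero_lt_one) le_rfl
  deriv r hr := ((hψ.differentiableOn (by norm_num)) r hr).hasDerivWithinAt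

/-- By this closure property a linear combination of scores is again governed by a single C¹
integrand. -/
lemma const_add_sum {ι : Type*} (s : Finset ι) (c : ℝ) (a : ι → ℝ) {ψ g : ι → ℝ → ℝ}
    (hψ : ∀ i ∈ s, HasContDerivOn (ψ i) (g i)) :
    HasContDerivOn (fun r => c + ∑ i ∈ s, a i * ψ i r) (fun r => ∑ i ∈ s, a i * g i r) where
  cont := continuousOn_finsetSum _ fun i hi => continuousOn_const.mul (hψ i hi).cont
  deriv r hr := (HasDerivWithinAt.fun_sum fun i hi =>
    ((hψ i hi).deriv r hr).const_mul (a i)).const_add c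

end HasContDerivOn

lemma sum_Icc_one_eq_sum_range {M : Type*} [AddCommMonoid M] (f : ℕ → M) (n : ℕ) :
    ∑ t ∈ Finset.Icc 1 n, f t = ∑ k ∈ Finset.range n, f (k + 1) := by
  rw [Finset.sum_bij' (fun t _ => t - 1) (fun k _ => k + 1)] <;> simp <;> grind

lemma sum_mul_sub_eq (p S : ℕ → ℝ) (hS : S 0 = 0) (n : ℕ) :
    ∑ k ∈ Finset.range n, p (k + 1) * (S (k + 1) - S k)
      = p n * S n - ∑ k ∈ Finset.range n, S k * (p (k + 1) - p k) := by
  induction n with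
  | zero => simp [hS]
  | succ n ih => rw [Finset.sum_range_succ, Finset.sum_range_succ, ih]; ring

lemma floor_mul_eq_of_mem_Ioo {n k : ℕ} {r : ℝ} (hn : 0 < n)
    (hr : r ∈ Set.Ioo ((k : ℝ) / n) (((k + 1 : ℕ) : ℝ) / n)) : ⌊r * n⌋₊ = k := by
  have hn' : (0 : ℝ) < n := by exact_mod_cast hn
  have h1 := (div_lt_iff₀ hn').1 hr.1
  have h2 := (lt_div_iff₀ hn').1 hr.2
  push_cast at h2
  rw [Nat.floor_eq_iff ((Nat.cast_nonneg k).trans h1.le)]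
  exact ⟨h1.le, h2⟩

/-- Summation by parts, with the remainder written as an integral of the step function
`r ↦ S ⌊r n⌋`. -/
lemma HasContDerivOn.sum_mul_increment {ψ g : ℝ → ℝ} (hψ : HasContDerivOn ψ g) (S : ℕ → ℝ)
    (hS : S 0 = 0) {n : ℕ} (hn : 0 < n) :
    ∑ k ∈ Finset.range n, ψ (((k + 1 : ℕ) : ℝ) / n) * (S (k + 1) - S k)
      = ψ 1 * S n - ∫ r in (0 : ℝ)..1, S ⌊r * n⌋₊ * g r := by
  have hn' : (0 : ℝ) < n := by exact_mod_cast hn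
  have hmem : ∀ k ≤ n, (k : ℝ) / n ∈ Set.Icc (0 : ℝ) 1 := fun k hk =>
    ⟨by positivity, (div_le_one hn').2 (by exact_mod_cast hk)⟩
  have hle : ∀ k : ℕ, (k : ℝ) / n ≤ ((k + 1 : ℕ) : ℝ) / n := fun k => by
    gcongr; simp
  have hae : ∀ k : ℕ, ∀ᵐ r : ℝ, r ∈ Set.uIoc ((k : ℝ) / n) (((k + 1 : ℕ) : ℝ) / n) →
      S k * g r = S ⌊r * n⌋₊ * g r := fun k => by
    -- At the right endpoint the floor already jumps to k + 1; that single point is null.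
    filter_upwards [compl_mem_ae_iff.2 (measure_singleton (((k + 1 : ℕ) : ℝ) / n))] with r hr hr'
    rw [Set.uIoc_of_le (hle k)] at hr'
    rw [floor_mul_eq_of_mem_Ioo hn ⟨hr'.1, lt_of_le_of_ne hr'.2 hr⟩]
  have hint : ∀ k < n, IntervalIntegrable (fun r => S k * g r) volume ((k : ℝ) / n)
      (((k + 1 : ℕ) : ℝ) / n) := fun k hk =>
    (hψ.intervalIntegrable (hmem k hk.le) (hmem (k + 1) hk)).const_mul _
  have hsum := intervalIntegral.sum_integral_adjacent_intervals
    (μ := volume) (a := fun k : ℕ => (k : ℝ) / n) (f := fun r => S ⌊r * n⌋₊ * g r) (n := n)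
    (fun k hk => (hint k hk).congr_ae
      ((ae_restrict_iff' measurableSet_uIoc).2 (hae k)))
  simp only [Nat.cast_zero, zero_div, div_self hn'.ne'] at hsum
  rw [← hsum, sum_mul_sub_eq (fun k => ψ ((k : ℝ) / n)) S hS n, div_self hn'.ne']
  congr 1
  refine Finset.sum_congr rfl fun k hk => ?_
  have hk := Finset.mem_range.1 hk
  rw [← intervalIntegral.integral_congr_ae (hae k), intervalIntegral.integral_const_mul,
    hψ.integral_eq_sub (hmem k hk.le) (hmem (k + 1) hk) (hle k)]

/-- Dominated convergence, since ⌊rn⌋/n → r and `B` is bounded on [0,1]. It is used with `B` the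
identity (Riemann sums) and with `B` a Brownian path. -/
lemma tendsto_integral_step_mul {B g : ℝ → ℝ} (hB : Continuous B)
    (hg : ContinuousOn g (Set.Icc 0 1)) :
    Tendsto (fun n : ℕ => ∫ r in (0 : ℝ)..1, B ((⌊r * n⌋₊ : ℝ) / n) * g r) atTop
      (𝓝 (∫ r in (0 : ℝ)..1, B r * g r)) := by
  obtain ⟨C, hC⟩ := isCompact_Icc.exists_bound_of_continuousOn
    (hB.continuousOn (s := Set.Icc (0 : ℝ) 1))
  have hgi : IntervalIntegrable g volume 0 1 := by
    refine ContinuousOn.intervalIntegrable ?_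
    rwa [Set.uIcc_of_le zero_le_one]
  refine intervalIntegral.tendsto_integral_filter_of_dominated_convergence
    (fun r => C * ‖g r‖) ?_ ?_ (hgi.norm.const_mul C) ?_
  · refine Eventually.of_forall fun n => AEStronglyMeasurable.mul ?_ ?_
    · refine Measurable.aestronglyMeasurable (hB.measurable.comp ?_)
      fun_prop
    · exact hgi.def'.aestronglyMeasurable
  · filter_upwards [eventually_gt_atTop 0] with n hn
    refine Eventually.of_forall fun r hr => ?_
    have hn' : (0 : ℝ) < n := by exact_mod_cast hn
    rw [Set.uIoc_of_le zero_le_one] at hr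
    rw [norm_mul]
    refine mul_le_mul_of_nonneg_right (hC _ ⟨by positivity, ?_⟩) (norm_nonneg _)
    rw [div_le_one hn']
    exact (Nat.floor_le (mul_nonneg hr.1.le hn'.le)).trans
      (mul_le_of_le_one_left hn'.le hr.2)
  · refine Eventually.of_forall fun r hr => ?_
    rw [Set.uIoc_of_le zero_le_one] at hr
    exact ((hB.tendsto r).comp ((tendsto_nat_floor_mul_div_atTop hr.1.le).comp
      tendsto_natCast_atTop_atTop)).mul_const _

/-- Summation by parts with S k = k/n, whose increments are 1/n, followed in the limit by
integration by parts for r · ψ(r). -/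
lemma HasContDerivOn.tendsto_riemannSum {ψ g : ℝ → ℝ} (hψ : HasContDerivOn ψ g) :
    Tendsto (fun n : ℕ => (1 / (n : ℝ)) * ∑ t ∈ Finset.Icc 1 n, ψ ((t : ℝ) / n)) atTop
      (𝓝 (∫ r in (0 : ℝ)..1, ψ r)) := by
  have h01 : (0 : ℝ) ∈ Set.Icc (0 : ℝ) 1 := by simp
  have h11 : (1 : ℝ) ∈ Set.Icc (0 : ℝ) 1 := by simp
  have hψi : IntervalIntegrable ψ volume 0 1 := by
    refine ContinuousOn.intervalIntegrable ?_
    rw [Set.uIcc_of_le zero_le_one]; exact hψ.continuousOn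
  have hgi : IntervalIntegrable (fun r => r * g r) volume 0 1 := by
    refine ContinuousOn.intervalIntegrable ?_
    rw [Set.uIcc_of_le zero_le_one]; exact continuousOn_id.mul hψ.cont
  have key : ∫ r in (0 : ℝ)..1, ψ r = ψ 1 - ∫ r in (0 : ℝ)..1, r * g r := by
    have := (HasContDerivOn.id.mul hψ).integral_eq_sub h01 h11 zero_le_one
    simp only [one_mul, zero_mul, sub_zero] at this
    rw [← this, intervalIntegral.integral_add hψi hgi]; ring
  rw [key]
  refine (tendsto_const_nhds.sub (tendsto_integral_step_mul continuous_id hψ.cont)).congr' ?_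
  filter_upwards [eventually_gt_atTop 0] with n hn
  have hn' : (0 : ℝ) < n := by exact_mod_cast hn
  have := hψ.sum_mul_increment (fun k => (k : ℝ) / n) (by simp) hn
  simp only [div_self hn'.ne', mul_one] at this
  rw [sum_Icc_one_eq_sum_range, Finset.mul_sum]
  simp only [_root_.id]
  rw [← this]
  refine Finset.sum_congr rfl fun k _ => ?_
  push_cast
  field_simp
  ring

/-! ### Continuous functionals on the Skorokhod space -/

/-- A right-continuous function has at most countably many discontinuities. -/
lemma countable_not_continuousAt_of_right_continuous {α E : Type*} [LinearOrder α]
    [TopologicalSpace α] [OrderTopology α] [SecondCountableTopology α] [PseudoMetricSpace E]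
    {f : α → E} (hf : ∀ r, ContinuousWithinAt f (Set.Ici r) r) :
    {r | ¬ ContinuousAt f r}.Countable := by
  set D : ℕ → Set α := fun n => {r | ¬ ∃ U ∈ 𝓝 r, ∀ a ∈ U, ∀ b ∈ U,
    dist (f a) (f b) < 1 / ((n : ℝ) + 1)}
  have hD : ∀ n, (D n).Countable := fun n => by
    -- `D n` collects the points where the oscillation is not below 1/(n+1). Right continuity makes
    -- the oscillation small at all points just to the right of r, so each point of `D n` is
    -- isolated from the right in `D n`; such a set is countable.
    refine (countable_setOfPred_isolated_right_within (s := D n)).mono fun r hr =>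
      Set.mem_ofPred.2 ⟨hr, ?_⟩
    have hpos : (0 : ℝ) < 1 / ((n : ℝ) + 1) := by positivity
    have hnear : ∀ᶠ s in 𝓝[>] r, dist (f s) (f r) < 1 / ((n : ℝ) + 1) / 2 :=
      (nhdsWithin_mono r Set.Ioi_subset_Ici_self)
        ((hf r).eventually (Metric.ball_mem_nhds (f r) (half_pos hpos)))
    obtain ⟨V, hV, hVo⟩ := mem_nhdsWithin.1 hnear
    have hempty : V ∩ (D n ∩ Set.Ioi r) = ∅ := by
      ext s
      simp only [Set.mem_inter_iff, Set.mem_empty_iff_false, iff_false, not_and]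
      intro hsV hsD hsr
      refine hsD ⟨V ∩ Set.Ioi r, (hV.inter isOpen_Ioi).mem_nhds ⟨hsV, hsr⟩, fun a ha b hb => ?_⟩
      have h1 := hVo.2 ha
      have h2 := hVo.2 hb
      simp only [Set.mem_ofPred_eq] at h1 h2
      rw [dist_comm] at h2
      linarith [dist_triangle (f a) (f r) (f b)]
    rw [← empty_mem_iff_bot, ← hempty]
    exact mem_nhdsWithin.2 ⟨V, hV, hVo.1, subset_rfl⟩
  refine (Set.countable_iUnion hD).mono fun r hr => ?_
  by_contra hcon
  refine hr (Metric.continuousAt_iff'.2 fun ε hε => ?_)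
  obtain ⟨n, hn⟩ := exists_nat_one_div_lt hε
  have hrn : r ∉ D n := fun h => hcon (Set.mem_iUnion.2 ⟨n, h⟩)
  rw [Set.mem_ofPred_eq, not_not] at hrn
  obtain ⟨U, hU, hUd⟩ := hrn
  filter_upwards [hU] with s hs
  exact (hUd s hs r (mem_of_mem_nhds hU)).trans hn

lemma measurable_of_countable_not_continuousAt {α E : Type*} [TopologicalSpace α]
    [MeasurableSpace α] [BorelSpace α] [MeasurableSingletonClass α]
    [TopologicalSpace E] [MeasurableSpace E] [BorelSpace E]
    {f : α → E} (hf : {r | ¬ ContinuousAt f r}.Countable) : Measurable f := by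
  refine measurable_of_restrict_of_restrict_compl hf.measurableSet ?_ ?_
  · have := hf.to_subtype
    exact measurable_of_countable _
  · refine Continuous.measurable (continuousOn_iff_continuous_domRestrict.1 fun r hr => ?_)
    exact (not_not.1 hr : ContinuousAt f r).continuousWithinAt

namespace Cadlag

variable {E : Type*} [MetricSpace E]

/-- One-sided limits bound the path near each point, and compactness of [0,1] patches the local
bounds together. -/
lemma exists_dist_le (x : Cadlag E) (e : E) : ∃ C, ∀ r, dist (x r) e ≤ C := by
  suffices h : ∃ C, ∀ r ∈ (Set.univ : Set unitInterval), dist (x r) e ≤ C by simpa using h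
  refine isCompact_univ.induction_on (p := fun s => ∃ C, ∀ r ∈ s, dist (x r) e ≤ C)
    ⟨0, by simp⟩ (fun s t hst ⟨C, hC⟩ => ⟨C, fun r hr => hC r (hst hr)⟩) ?_ ?_
  · rintro s t ⟨C, hC⟩ ⟨C', hC'⟩
    refine ⟨max C C', fun r hr => ?_⟩
    rcases hr with hr | hr
    · exact (hC r hr).trans (le_max_left _ _)
    · exact (hC' r hr).trans (le_max_right _ _)
  · intro r _
    obtain ⟨l, hl⟩ := x.left_limits r
    have h1 := hl.eventually (Metric.ball_mem_nhds l one_pos)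
    have h2 := (x.right_continuous r).eventually (Metric.ball_mem_nhds (x r) one_pos)
    refine ⟨{s | dist (x s) e ≤ max (dist l e + 1) (dist (x r) e + 1)}, ?_, _,
      fun s hs => Set.mem_ofPred.1 hs⟩
    rw [nhdsWithin_univ, ← nhdsLT_sup_nhdsGE r]
    refine ⟨?_, ?_⟩
    · filter_upwards [h1] with s hs
      exact le_max_of_le_left (by linarith [dist_triangle (x s) l e, Metric.mem_ball.1 hs])
    · filter_upwards [h2] with s hs
      exact le_max_of_le_right (by linarith [dist_triangle (x s) (x r) e, Metric.mem_ball.1 hs])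

/-- Balls are subbasic open sets by definition of the topology, so no triangle inequality for the
Skorokhod distance is needed. -/
lemma skorokhodBall_mem_nhds (x : Cadlag E) {ε : ℝ} (hε : 0 < ε) : skorokhodBall x ε ∈ 𝓝 x := by
  have hx : x ∈ skorokhodBall x ε := by
    rw [skorokhodBall, Set.mem_ofPred_eq]
    exact ⟨OrderIso.refl _, 0, hε, by simp, by simp⟩
  have ho : IsOpen (skorokhodBall x ε) :=
    TopologicalSpace.isOpen_generateFrom_of_mem (Set.mem_ofPred.2 ⟨x, ε, rfl⟩)
  exact ho.mem_nhds hx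

/-- Continuity of a functional on the Skorokhod space can be tested along sequences in shrinking
balls. -/
lemma continuous_of_seq {F : Type*} [PseudoMetricSpace F] {f : Cadlag E → F}
    (hf : ∀ (x : Cadlag E) (y : ℕ → Cadlag E),
      (∀ n : ℕ, y n ∈ skorokhodBall x (1 / ((n : ℝ) + 1))) →
        Tendsto (fun n => f (y n)) atTop (𝓝 (f x))) : Continuous f := by
  refine continuous_iff_continuousAt.2 fun x => Metric.continuousAt_iff'.2 fun η hη => ?_
  by_contra hcon
  have hex : ∀ n : ℕ, ∃ y ∈ skorokhodBall x (1 / ((n : ℝ) + 1)), η ≤ dist (f y) (f x) := fun n => by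
    by_contra! h
    exact hcon (mem_of_superset (skorokhodBall_mem_nhds x (by positivity)) h)
  choose y hy hyη using hex
  obtain ⟨n, hn⟩ := ((hf x y hy).eventually (Metric.ball_mem_nhds (f x) hη)).exists
  exact (hyη n).not_gt hn

/-- `y n r` is within 1/(n+1) of x at the back-transformed time τ_n⁻¹ r, and τ_n⁻¹ r → r. -/
lemma tendsto_apply_of_mem_skorokhodBall {x : Cadlag E} {y : ℕ → Cadlag E}
    (hy : ∀ n : ℕ, y n ∈ skorokhodBall x (1 / ((n : ℝ) + 1))) {r : unitInterval}
    (hr : ContinuousAt x r) : Tendsto (fun n => y n r) atTop (𝓝 (x r)) := by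
  choose τ δ hδ hτ hxy using hy
  have hlim := tendsto_one_div_add_atTop_nhds_zero_nat (𝕜 := ℝ)
  have hinv : Tendsto (fun n => (τ n).symm r) atTop (𝓝 r) := by
    refine tendsto_iff_dist_tendsto_zero.2 (squeeze_zero (fun _ => dist_nonneg) (fun n => ?_) hlim)
    have := hτ n ((τ n).symm r)
    rw [OrderIso.apply_symm_apply, dist_comm] at this
    exact this.trans (hδ n).le
  refine tendsto_of_tendsto_of_dist (hr.tendsto.comp hinv)
    (squeeze_zero (fun _ => dist_nonneg) (fun n => ?_) hlim)
  have := hxy n ((τ n).symm r)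
  rw [OrderIso.apply_symm_apply] at this
  exact this.trans (hδ n).le

/-- Evaluation at an interior time is not Skorokhod continuous, but every increasing bijection of
[0,1] fixes 1. -/
lemma continuous_eval_one : Continuous fun x : Cadlag E => x 1 := by
  refine continuous_of_seq fun x y hy => ?_
  choose τ δ hδ hτ hxy using hy
  refine tendsto_iff_dist_tendsto_zero.2 (squeeze_zero (fun _ => dist_nonneg) (fun n => ?_)
    (tendsto_one_div_add_atTop_nhds_zero_nat (𝕜 := ℝ)))
  have h := hxy n 1
  have h1 : τ n 1 = 1 := (τ n).map_top
  rw [h1, dist_comm] at h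
  exact h.trans (hδ n).le

lemma exists_dist_le_of_mem_skorokhodBall {x : Cadlag E} {y : ℕ → Cadlag E}
    (hy : ∀ n : ℕ, y n ∈ skorokhodBall x (1 / ((n : ℝ) + 1))) (e : E) :
    ∃ C, ∀ n r, dist (y n r) e ≤ C := by
  obtain ⟨C, hC⟩ := x.exists_dist_le e
  refine ⟨1 + C, fun n r => ?_⟩
  obtain ⟨τ, δ, hδ, -, hxy⟩ := hy n
  have h1 := hxy (τ.symm r)
  rw [OrderIso.apply_symm_apply, dist_comm] at h1
  have h2 : 1 / ((n : ℝ) + 1) ≤ 1 := by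
    rw [div_le_one (by positivity)]; linarith [(Nat.cast_nonneg n : (0 : ℝ) ≤ n)]
  linarith [dist_triangle (y n r) (x (τ.symm r)) e, hC (τ.symm r)]

lemma ae_continuousAt_projIcc (x : Cadlag E) :
    ∀ᵐ r : ℝ, r ∈ Set.uIoc (0 : ℝ) 1 → ContinuousAt x (Set.projIcc 0 1 zero_le_one r) := by
  have hc : ((Subtype.val : unitInterval → ℝ) '' {r | ¬ ContinuousAt x r}).Countable :=
    (countable_not_continuousAt_of_right_continuous x.right_continuous).image _
  filter_upwards [hc.ae_notMem volume] with r hr hr01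
  rw [Set.uIoc_of_le zero_le_one] at hr01
  by_contra hcon
  exact hr ⟨_, hcon, by rw [Set.projIcc_of_mem zero_le_one ⟨hr01.1.le, hr01.2⟩]⟩

/-- Skorokhod convergence gives pointwise convergence at the continuity points of the limit, hence
almost everywhere, together with a uniform bound; dominated convergence applies. -/
lemma continuous_integral_mul {ι : Type*} [Fintype ι] (j : ι) {g : ℝ → ℝ}
    (hg : IntervalIntegrable g volume 0 1) :
    Continuous fun x : Cadlag (ι → ℝ) =>
      ∫ r in (0 : ℝ)..1, x (Set.projIcc 0 1 zero_le_one r) j * g r := by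
  refine continuous_of_seq fun x y hy => ?_
  obtain ⟨C, hC⟩ := exists_dist_le_of_mem_skorokhodBall hy 0
  refine intervalIntegral.tendsto_integral_filter_of_dominated_convergence
    (fun r => C * ‖g r‖) ?_ ?_ (hg.norm.const_mul C) ?_
  · refine Eventually.of_forall fun n => AEStronglyMeasurable.mul ?_ hg.def'.aestronglyMeasurable
    have hm : Measurable (y n) := measurable_of_countable_not_continuousAt
      (countable_not_continuousAt_of_right_continuous (y n).right_continuous)
    exact ((measurable_pi_apply j).comp (hm.comp
      continuous_projIcc.measurable)).aestronglyMeasurable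
  · refine Eventually.of_forall fun n => Eventually.of_forall fun r _ => ?_
    rw [norm_mul]
    refine mul_le_mul_of_nonneg_right ?_ (norm_nonneg _)
    have := (dist_le_pi_dist (y n (Set.projIcc 0 1 zero_le_one r)) 0 j).trans (hC n _)
    simpa [Real.dist_eq] using this
  · filter_upwards [x.ae_continuousAt_projIcc] with r hr hr'
    exact (((continuous_apply j).tendsto _).comp
      (tendsto_apply_of_mem_skorokhodBall hy (hr hr'))).mul_const _

end Cadlag

/-! ### Wiener integrals of continuously differentiable functions -/

section Wiener

variable {Ω' : Type*} [MeasurableSpace Ω'] {P' : Measure Ω'} {B : ℝ≥0 → Ω' → ℝ}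

lemma coe_nndist_grid {n : ℕ} (hn : 0 < n) (k : ℕ) :
    ((nndist (((((k + 1 : ℕ) : ℝ) / n).toNNReal : ℝ≥0) : ℝ) ((((k : ℝ) / n).toNNReal : ℝ≥0) : ℝ) :
      ℝ≥0) : ℝ) = 1 / n := by
  have hn' : (0 : ℝ) < n := by exact_mod_cast hn
  rw [coe_nndist, Real.coe_toNNReal _ (by positivity), Real.coe_toNNReal _ (by positivity),
    Real.dist_eq, ← sub_div]
  push_cast
  rw [add_sub_cancel_left, abs_of_pos (by positivity)]

/-- The characteristic function of a weighted sum of Brownian increments over a regular grid. -/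
lemma integral_cexp_sum_mul_increment [IsProbabilityMeasure P'] (hB : IsPreBrownianReal B P')
    (c : ℕ → ℝ) {n : ℕ} (hn : 0 < n) :
    ∫ ω, Complex.exp (((∑ k ∈ Finset.range n, c k *
        (B (((k + 1 : ℕ) : ℝ) / n).toNNReal ω - B ((k : ℝ) / n).toNNReal ω) : ℝ) : ℂ)
          * Complex.I) ∂P'
      = Complex.exp (-(((1 / (n : ℝ)) * ∑ k ∈ Finset.range n, c k ^ 2 : ℝ) : ℂ) / 2) := by
  set X : ℕ → Ω' → ℝ := fun k ω =>
    B (((k + 1 : ℕ) : ℝ) / n).toNNReal ω - B ((k : ℝ) / n).toNNReal ω with hX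
  have hXm : ∀ k, AEMeasurable (X k) P' := fun k => (hB.aemeasurable _).sub (hB.aemeasurable _)
  have hmono : Monotone fun k : ℕ => ((k : ℝ) / n).toNNReal := fun a b hab =>
    Real.toNNReal_le_toNNReal (by gcongr)
  have hindep : iIndepFun (fun k ω => c k * X k ω) P' :=
    (hB.hasIndepIncrements.nat hmono).comp (fun k x => c k * x) (fun k => by fun_prop)
  have hm : ∀ k ∈ Finset.range n, AEMeasurable (fun ω => c k * X k ω) P' :=
    fun k _ => (hXm k).const_mul _
  have hchar := congrFun ((hindep.restrict (Finset.range n)).charFun_map_fun_finsetSum_eq_prod hm) 1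
  rw [charFun_apply_real, integral_map (Finset.aemeasurable_fun_sum _ hm)
    (by fun_prop), Finset.prod_apply] at hchar
  simp only [Complex.ofReal_one, one_mul] at hchar
  rw [hchar]
  have hterm : ∀ k, charFun (P'.map fun ω => c k * X k ω) 1
      = Complex.exp (-((1 / (n : ℝ) * c k ^ 2 : ℝ) : ℂ) / 2) := fun k => by
    obtain ⟨v, hv, hlaw⟩ : ∃ v : ℝ≥0, (v : ℝ) = 1 / n ∧ P'.map (X k) = gaussianReal 0 v :=
      ⟨_, coe_nndist_grid hn k, (hB.hasLaw_sub _ _).map_eq⟩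
    rw [charFun_map_mul_comp (hXm k), hlaw, charFun_gaussianReal]
    congr 1
    rw [show ((v : ℝ≥0) : ℂ) = ((v : ℝ) : ℂ) from rfl, hv]
    push_cast
    ring
  simp_rw [hterm]
  rw [← Complex.exp_sum]
  congr 1
  rw [Finset.mul_sum]
  push_cast
  rw [neg_div, ← Finset.sum_div, Finset.sum_neg_distrib, neg_div]

/-- The Wiener integral of a continuously differentiable `ψ`, written by parts, is a centered
Gaussian with variance `∫ ψ²`. -/
lemma integral_cexp_wienerIntegral [IsProbabilityMeasure P'] (hB : IsBrownianReal B P')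
    {ψ g : ℝ → ℝ} (hψ : HasContDerivOn ψ g) :
    ∫ ω, Complex.exp (((ψ 1 * B 1 ω - ∫ r in (0 : ℝ)..1, B r.toNNReal ω * g r : ℝ) : ℂ)
        * Complex.I) ∂P'
      = Complex.exp (-((∫ r in (0 : ℝ)..1, ψ r ^ 2 : ℝ) : ℂ) / 2) := by
  -- The Riemann–Stieltjes sums of ψ against B. Their characteristic functions are passed to the
  -- limit in two ways: pathwise, by parts, and through the explicit Gaussian formula, whose
  -- variance is a Riemann sum of ψ².
  set F : ℕ → Ω' → ℝ := fun n ω => ∑ k ∈ Finset.range n, ψ (((k + 1 : ℕ) : ℝ) / n) *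
        (B (((k + 1 : ℕ) : ℝ) / n).toNNReal ω - B ((k : ℝ) / n).toNNReal ω) with hF
  have hlim1 : Tendsto (fun n => ∫ ω, Complex.exp ((F n ω : ℂ) * Complex.I) ∂P') atTop
      (𝓝 (∫ ω, Complex.exp (((ψ 1 * B 1 ω - ∫ r in (0 : ℝ)..1, B r.toNNReal ω * g r : ℝ) : ℂ)
        * Complex.I) ∂P')) := by
    refine tendsto_integral_of_dominated_convergence (fun _ => 1) (fun n => ?_)
      (integrable_const _) (fun n => Eventually.of_forall fun ω => ?_) ?_
    · have hFm : AEMeasurable (F n) P' := Finset.aemeasurable_fun_sum _ fun k _ =>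
        ((hB.aemeasurable _).sub (hB.aemeasurable _)).const_mul _
      have : Continuous fun x : ℝ => Complex.exp ((x : ℂ) * Complex.I) := by fun_prop
      exact (this.measurable.comp_aemeasurable hFm).aestronglyMeasurable
    · rw [Complex.norm_exp_ofReal_mul_I]
    · filter_upwards [hB.cont, hB.eval_zero_ae_eq_zero] with ω hc h0
      have hstep := tendsto_integral_step_mul (hc.comp continuous_real_toNNReal) hψ.cont
      have hFlim : Tendsto (fun n => F n ω) atTop
          (𝓝 (ψ 1 * B 1 ω - ∫ r in (0 : ℝ)..1, B r.toNNReal ω * g r)) := by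
        refine (tendsto_const_nhds.sub hstep).congr' ?_
        filter_upwards [eventually_gt_atTop 0] with n hn
        have hn' : (n : ℝ) ≠ 0 := by exact_mod_cast hn.ne'
        have := hψ.sum_mul_increment (fun k => B ((k : ℝ) / n).toNNReal ω) (by simpa using h0) hn
        simp only [div_self hn', Real.toNNReal_one] at this
        exact this.symm
      have : Continuous fun x : ℝ => Complex.exp ((x : ℂ) * Complex.I) := by fun_prop
      exact (this.tendsto _).comp hFlim
  have hlim2 : Tendsto (fun n => ∫ ω, Complex.exp ((F n ω : ℂ) * Complex.I) ∂P') atTop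
      (𝓝 (Complex.exp (-((∫ r in (0 : ℝ)..1, ψ r ^ 2 : ℝ) : ℂ) / 2))) := by
    have hR := (hψ.mul hψ).tendsto_riemannSum
    simp only [← pow_two] at hR
    have : Continuous fun x : ℝ => Complex.exp (-(x : ℂ) / 2) := by fun_prop
    refine ((this.tendsto _).comp hR).congr' ?_
    filter_upwards [eventually_gt_atTop 0] with n hn
    rw [integral_cexp_sum_mul_increment hB.toIsPreBrownianReal _ hn, Function.comp_apply,
      sum_Icc_one_eq_sum_range]
  exact tendsto_nhds_unique hlim1 hlim2

end Wiener

/-! ### Score vectors as functionals of the partial sum process -/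

/-- The vector `T^{-1/2} ∑_{t=1}^T (1, φ_1(t/T), …, φ_K(t/T)) v_t`. -/
noncomputable def scoreVector {K : ℕ} (φ : Fin K → ℝ → ℝ) (T : ℕ) (v : ℕ → ℝ) : Fin (K + 1) → ℝ :=
  Fin.cons ((1 / √(T : ℝ)) * ∑ t ∈ Finset.Icc 1 T, v t)
    fun l => (1 / √(T : ℝ)) * ∑ t ∈ Finset.Icc 1 T, φ l ((t : ℝ) / T) * v t

/-- The functional of the `j`-th coordinate of the partial sum process giving the score vector;
`g l` is the derivative of `φ l`. -/
noncomputable def scoreFunctional {K : ℕ} (φ g : Fin K → ℝ → ℝ) (j : Fin 2)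
    (x : Cadlag (Fin 2 → ℝ)) : Fin (K + 1) → ℝ :=
  Fin.cons (x 1 j) fun l =>
    φ l 1 * x 1 j - ∫ r in (0 : ℝ)..1, x (Set.projIcc 0 1 zero_le_one r) j * g l r

section Score

variable {K : ℕ} {φ g : Fin K → ℝ → ℝ}

lemma continuous_scoreFunctional (hφ : ∀ l, HasContDerivOn (φ l) (g l)) (j : Fin 2) :
    Continuous (scoreFunctional φ g j) := by
  have h1 : Continuous fun x : Cadlag (Fin 2 → ℝ) => x 1 j :=
    (continuous_apply j).comp Cadlag.continuous_eval_one
  refine continuous_pi fun i => ?_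
  refine Fin.cases ?_ (fun l => ?_) i
  · simpa [scoreFunctional] using h1
  · simp only [scoreFunctional, Fin.cons_succ]
    exact (continuous_const.mul h1).sub (Cadlag.continuous_integral_mul j
      ((hφ l).intervalIntegrable (by simp) (by simp)))

lemma partialSumProcess_apply (u : Fin 2 → ℕ → ℝ) (T : ℕ) (r : unitInterval) (j : Fin 2) :
    partialSumProcess (fun t j => u j t) T r j
      = (1 / √(T : ℝ)) * ∑ t ∈ Finset.Icc 1 ⌊(r : ℝ) * T⌋₊, u j t := by
  simp [partialSumProcess]

/-- Summation by parts applied to the scaled partial sums; the identity is exact, with no remainder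
to control. -/
lemma scoreFunctional_partialSumProcess (hφ : ∀ l, HasContDerivOn (φ l) (g l)) (j : Fin 2)
    (u : Fin 2 → ℕ → ℝ) {T : ℕ} (hT : 0 < T) :
    scoreFunctional φ g j (partialSumProcess (fun t j => u j t) T) = scoreVector φ T (u j) := by
  have h1 : partialSumProcess (fun t j => u j t) T 1 j
      = (1 / √(T : ℝ)) * ∑ t ∈ Finset.Icc 1 T, u j t := by
    rw [partialSumProcess_apply]; simp
  funext i
  refine Fin.cases ?_ (fun l => ?_) i
  · simpa [scoreFunctional, scoreVector] using h1
  · simp only [scoreFunctional, scoreVector, Fin.cons_succ]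
    have hsum := (hφ l).sum_mul_increment
      (fun k => (1 / √(T : ℝ)) * ∑ t ∈ Finset.Icc 1 k, u j t) (by simp) hT
    rw [h1]
    calc _ = φ l 1 * ((1 / √(T : ℝ)) * ∑ t ∈ Finset.Icc 1 T, u j t)
          - ∫ r in (0 : ℝ)..1,
            ((1 / √(T : ℝ)) * ∑ t ∈ Finset.Icc 1 ⌊r * T⌋₊, u j t) * g l r := by
          congr 1
          refine intervalIntegral.integral_congr fun r hr => ?_
          rw [Set.uIcc_of_le zero_le_one] at hr
          simp only [partialSumProcess_apply, Set.projIcc_of_mem zero_le_one hr]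
      _ = _ := by
          rw [← hsum, sum_Icc_one_eq_sum_range, Finset.mul_sum]
          refine Finset.sum_congr rfl fun k _ => ?_
          rw [Finset.sum_Icc_succ_top (by omega)]
          ring

/-- The model constrains the errors only for t ≥ 1 and states independence for the sequences k ↦ u
(k + 1); this puts the scores in that form. -/
lemma scoreVector_eq_shift (T : ℕ) (v : ℕ → ℝ) :
    scoreVector φ T v = scoreVector φ T fun t => (fun k => v (k + 1)) (t - 1) := by
  have hv : ∀ t ∈ Finset.Icc 1 T, v t = v (t - 1 + 1) := fun t ht => by
    rw [Nat.sub_add_cancel (Finset.mem_Icc.1 ht).1]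
  unfold scoreVector
  congr 1
  · rw [Finset.sum_congr rfl hv]
  · funext l
    rw [Finset.sum_congr rfl fun t ht => by rw [hv t ht]]

lemma measurable_scoreVector_shift (T : ℕ) :
    Measurable fun w : ℕ → ℝ => scoreVector φ T fun t => w (t - 1) := by
  refine measurable_pi_lambda _ fun i => ?_
  refine Fin.cases ?_ (fun l => ?_) i
  · simp only [scoreVector, Fin.cons_zero]; fun_prop
  · simp only [scoreVector, Fin.cons_succ]; fun_prop

lemma aemeasurable_scoreVector {Ω : Type*} [MeasurableSpace Ω] {P : Measure Ω} {v : ℕ → Ω → ℝ}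
    (hv : ∀ t, 1 ≤ t → AEMeasurable (v t) P) (T : ℕ) :
    AEMeasurable (fun ω => scoreVector φ T fun t => v t ω) P := by
  have h : (fun ω => scoreVector φ T fun t => v t ω)
      = (fun w => scoreVector φ T fun t => w (t - 1)) ∘ fun ω k => v (k + 1) ω :=
    funext fun ω => scoreVector_eq_shift T _
  rw [h]
  exact (measurable_scoreVector_shift T).comp_aemeasurable
    (aemeasurable_pi_lambda _ fun k => hv (k + 1) (by omega))

/-- Demeaning costs a grid mean of φ_l times the leading score, which is negligible once ∫ φ_l = 0.
-/
lemma projCoeff_eq_scoreVector (l : Fin K) (T : ℕ) (v : ℕ → ℝ) :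
    projCoeff (φ l) v T = scoreVector φ T v l.succ
      - ((1 / (T : ℝ)) * ∑ t ∈ Finset.Icc 1 T, φ l ((t : ℝ) / T)) * scoreVector φ T v 0 := by
  simp only [projCoeff, scoreVector, Fin.cons_succ, Fin.cons_zero, sampleMean, mul_sub,
    Finset.sum_sub_distrib, ← Finset.sum_mul]
  ring

lemma sampleMean_const_add (m : ℝ) (v : ℕ → ℝ) {T : ℕ} (hT : 0 < T) :
    sampleMean (fun t => m + v t) T = m + sampleMean v T := by
  have : (T : ℝ) ≠ 0 := by exact_mod_cast hT.ne'
  simp only [sampleMean, Finset.sum_add_distrib, Finset.sum_const, Nat.card_Icc, nsmul_eq_mul]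
  field_simp
  push_cast [Nat.add_sub_cancel]
  ring

lemma projCoeff_const_add (f : ℝ → ℝ) (m : ℝ) (v : ℕ → ℝ) {T : ℕ} (hT : 0 < T) :
    projCoeff f (fun t => m + v t) T = projCoeff f v T := by
  simp only [projCoeff, sampleMean_const_add m v hT, add_sub_add_left_eq_sub]

lemma sampleMean_eq_scoreVector (φ : Fin K → ℝ → ℝ) (T : ℕ) (v : ℕ → ℝ) :
    sampleMean v T = (1 / √(T : ℝ)) * scoreVector φ T v 0 := by
  simp only [sampleMean, scoreVector, Fin.cons_zero]
  rw [← mul_assoc]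
  congr 1
  rw [div_mul_div_comm, Real.mul_self_sqrt (Nat.cast_nonneg T), one_mul]

end Score

/-! ### Limits of characteristic functions of score vectors -/

section Limit

variable {Ω Ω' : Type*} [MeasurableSpace Ω] [MeasurableSpace Ω']
  {P : Measure Ω} [IsProbabilityMeasure P] {P' : Measure Ω'} [IsProbabilityMeasure P']
  {K : ℕ} {φ g : Fin K → ℝ → ℝ}

/-- A linear combination of the scores of `√v B` is a Wiener integral. -/
lemma sum_mul_scoreFunctional (hφ : ∀ l, HasContDerivOn (φ l) (g l)) (j : Fin 2)
    (s : Fin (K + 1) → ℝ)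
    (x : Cadlag (Fin 2 → ℝ)) (c : ℝ) {b : ℝ≥0 → ℝ} (hb : Continuous b)
    (hx : ∀ r : unitInterval, x r j = c * b ⟨(r : ℝ), r.2.1⟩) :
    ∑ i, s i * scoreFunctional φ g j x i
      = (c * s 0 + ∑ l, c * s (Fin.succ l) * φ l 1) * b 1
        - ∫ r in (0 : ℝ)..1, b r.toNNReal * ∑ l, c * s (Fin.succ l) * g l r := by
  have hx1 : x 1 j = c * b 1 := hx 1
  have hint : ∀ l, ∫ r in (0 : ℝ)..1, x (Set.projIcc 0 1 zero_le_one r) j * g l r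
      = ∫ r in (0 : ℝ)..1, c * (b r.toNNReal * g l r) := fun l => by
    refine intervalIntegral.integral_congr fun r hr => ?_
    rw [Set.uIcc_of_le zero_le_one] at hr
    simp only [Set.projIcc_of_mem zero_le_one hr, hx, Real.toNNReal_of_nonneg hr.1]
    exact mul_assoc _ _ _
  have hbg : ∀ l, IntervalIntegrable (fun r => b r.toNNReal * g l r) volume 0 1 := fun l => by
    refine ContinuousOn.intervalIntegrable ?_
    rw [Set.uIcc_of_le zero_le_one]
    exact (hb.comp continuous_real_toNNReal).continuousOn.mul (hφ l).cont
  have hsum : ∫ r in (0 : ℝ)..1, b r.toNNReal * ∑ l, c * s (Fin.succ l) * g l r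
      = ∑ l, c * s (Fin.succ l) * ∫ r in (0 : ℝ)..1, b r.toNNReal * g l r := by
    simp_rw [Finset.mul_sum, mul_left_comm (b _)]
    rw [intervalIntegral.integral_finsetSum fun l _ => (hbg l).const_mul _]
    simp_rw [intervalIntegral.integral_const_mul]
  rw [Fin.sum_univ_succ, hsum]
  simp only [scoreFunctional, Fin.cons_zero, Fin.cons_succ, hint,
    intervalIntegral.integral_const_mul, hx1]
  rw [add_mul, Finset.sum_mul, add_sub_assoc, ← Finset.sum_sub_distrib]
  congr 1
  · ring
  · exact Finset.sum_congr rfl fun l _ => by ring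

/-- The weights vary with n because, in the application, they contain the sample weights and grid
means; `T` is an arbitrary divergent sequence so that subsequences are covered. -/
lemma tendsto_charFun_scoreVector {u : Fin 2 → ℕ → Ω → ℝ} {lrv : Fin 2 → ℝ}
    {W : Fin 2 → ℝ≥0 → Ω' → ℝ} (hW : IsStandardBrownian₂ W P') (hF : FunctionalCLT P P' u lrv W)
    (j : Fin 2) (hlrv : 0 ≤ lrv j) (hφ : ∀ l, HasContDerivOn (φ l) (g l))
    (hquad : ∀ s : Fin (K + 1) → ℝ,
      ∫ r in (0 : ℝ)..1, (s 0 + ∑ l, s (Fin.succ l) * φ l r) ^ 2 = ∑ i, s i ^ 2)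
    {T : ℕ → ℕ} (hT : Tendsto T atTop atTop) {s : ℕ → Fin (K + 1) → ℝ} {s₀ : Fin (K + 1) → ℝ}
    (hs : Tendsto s atTop (𝓝 s₀)) :
    Tendsto (fun n => charFun (P.map fun ω =>
        ∑ i, s n i * scoreVector φ (T n) (fun t => u j t ω) i) 1) atTop
      (𝓝 (Complex.exp (-((lrv j * ∑ i, s₀ i ^ 2 : ℝ) : ℂ) / 2))) := by
  obtain ⟨Z, hZ, hconv⟩ := hF
  have hconvT : TendstoInDistribution
      (fun (n : ℕ) (ω : Ω) => partialSumProcess (fun t => fun j => u j t ω) (T n))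
      atTop Z (fun _ => P) P' :=
    ⟨fun n => hconv.forall_aemeasurable (T n), hconv.aemeasurable_limit, hconv.tendsto.comp hT⟩
  have hV := hconvT.continuous_comp (continuous_scoreFunctional hφ j)
  have hdot : Continuous fun p : (Fin (K + 1) → ℝ) × (Fin (K + 1) → ℝ) => ∑ i, p.2 i * p.1 i := by
    fun_prop
  -- Slutsky's theorem, with the deterministic weights regarded as constant random vectors.
  have hconst : TendstoInMeasure P (fun n (_ : Ω) => s n) atTop fun _ => s₀ :=
    tendstoInMeasure_of_tendsto_ae (fun _ => aestronglyMeasurable_const)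
      (Eventually.of_forall fun _ => hs)
  have hS := hV.continuous_comp_prodMk_of_tendstoInMeasure_const hdot hconst
    (fun _ => aemeasurable_const)
  have hchar := ProbabilityMeasure.tendsto_iff_tendsto_charFun.1 hS.tendsto 1
  simp only [ProbabilityMeasure.coe_mk, Function.comp_apply] at hchar
  have hlim : charFun (P'.map fun ω => ∑ i, s₀ i * scoreFunctional φ g j (Z ω) i) 1
      = Complex.exp (-((lrv j * ∑ i, s₀ i ^ 2 : ℝ) : ℂ) / 2) := by
    have hWi := integral_cexp_wienerIntegral (hW.isBrownian j)
      (HasContDerivOn.const_add_sum Finset.univ (√(lrv j) * s₀ 0)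
        (fun l => √(lrv j) * s₀ (Fin.succ l)) fun l _ => hφ l)
    have hsq : ∫ r in (0 : ℝ)..1,
        (√(lrv j) * s₀ 0 + ∑ l, √(lrv j) * s₀ (Fin.succ l) * φ l r) ^ 2
          = lrv j * ∑ i, s₀ i ^ 2 := by
      rw [← hquad s₀, ← intervalIntegral.integral_const_mul]
      refine intervalIntegral.integral_congr fun r _ => ?_
      simp only [mul_assoc, ← Finset.mul_sum]
      rw [← mul_add, mul_pow, Real.sq_sqrt hlrv]
    rw [hsq] at hWi
    have hm : AEMeasurable (fun ω => ∑ i, s₀ i * scoreFunctional φ g j (Z ω) i) P' :=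
      hS.aemeasurable_limit
    rw [charFun_apply_real, integral_map hm (by fun_prop), ← hWi]
    refine integral_congr_ae ?_
    filter_upwards [hZ, (hW.isBrownian j).cont] with ω hω hc
    simp only [Complex.ofReal_one, one_mul]
    rw [sum_mul_scoreFunctional hφ j s₀ (Z ω) (√(lrv j)) hc fun r => hω r j]
  rw [← hlim]
  refine hchar.congr' ?_
  filter_upwards [hT.eventually_gt_atTop 0] with n hn
  simp_rw [scoreFunctional_partialSumProcess hφ j (fun j t => u j t _) hn]

end Limit

/-! ### Orthonormality -/

lemma intervalIntegrable_fun_sum {ι : Type*} [Fintype ι] {f : ι → ℝ → ℝ} {a b : ℝ}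
    (hf : ∀ i, IntervalIntegrable (f i) volume a b) :
    IntervalIntegrable (fun r => ∑ i, f i r) volume a b := by
  have := IntervalIntegrable.sum Finset.univ fun i _ => hf i
  rwa [Finset.sum_fn] at this

/-- Parseval for 1, φ_1, …, φ_K: mean zero is orthogonality to the constant 1. -/
lemma IsBasisFamily.integral_sq {φ : ℕ → ℝ → ℝ} {M : ℕ} (hφ : IsBasisFamily φ M) {K : ℕ}
    (hK : K ≤ M) (s : Fin (K + 1) → ℝ) :
    ∫ r in (0 : ℝ)..1, (s 0 + ∑ l : Fin K, s (Fin.succ l) * φ (l + 1) r) ^ 2 = ∑ i, s i ^ 2 := by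
  have hmem : ∀ l : Fin K, (l : ℕ) + 1 ∈ Finset.Icc 1 M := fun l =>
    Finset.mem_Icc.2 ⟨by omega, by have := l.2; omega⟩
  have hc : ∀ l : Fin K, ContinuousOn (φ (l + 1)) (Set.uIcc 0 1) := fun l => by
    rw [Set.uIcc_of_le zero_le_one]; exact (hφ.contDiffOn _ (hmem l)).continuousOn
  have hexp : ∀ r, (s 0 + ∑ l : Fin K, s (Fin.succ l) * φ (l + 1) r) ^ 2
      = s 0 ^ 2 + ((∑ l : Fin K, (2 * s 0 * s (Fin.succ l)) * φ (l + 1) r)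
        + ∑ k : Fin K, ∑ l : Fin K, (s (Fin.succ k) * s (Fin.succ l)) *
            (φ (k + 1) r * φ (l + 1) r)) := fun r => by
    rw [add_sq, add_assoc]
    congr 2
    · rw [Finset.mul_sum]; exact Finset.sum_congr rfl fun l _ => by ring
    · rw [sq, Finset.sum_mul_sum]
      exact Finset.sum_congr rfl fun k _ => Finset.sum_congr rfl fun l _ => by ring
  have hi1 : ∀ l : Fin K, IntervalIntegrable
      (fun r => (2 * s 0 * s (Fin.succ l)) * φ (l + 1) r) volume 0 1 := fun l =>
    (hc l).intervalIntegrable.const_mul _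
  have hi2 : ∀ k l : Fin K, IntervalIntegrable
      (fun r => (s (Fin.succ k) * s (Fin.succ l)) * (φ (k + 1) r * φ (l + 1) r)) volume 0 1 :=
    fun k l => (((hc k).mul (hc l)).intervalIntegrable).const_mul _
  have hi3 : ∀ k : Fin K, IntervalIntegrable (fun r => ∑ l : Fin K,
      (s (Fin.succ k) * s (Fin.succ l)) * (φ (k + 1) r * φ (l + 1) r)) volume 0 1 := fun k =>
    intervalIntegrable_fun_sum fun l => hi2 k l
  simp_rw [hexp]
  rw [intervalIntegral.integral_add (by simp)
      ((intervalIntegrable_fun_sum fun l => hi1 l).add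
        (intervalIntegrable_fun_sum fun k => hi3 k)),
    intervalIntegral.integral_add (intervalIntegrable_fun_sum fun l => hi1 l)
      (intervalIntegrable_fun_sum fun k => hi3 k),
    intervalIntegral.integral_finsetSum fun l _ => hi1 l,
    intervalIntegral.integral_finsetSum fun k _ => hi3 k, Fin.sum_univ_succ]
  simp_rw [intervalIntegral.integral_finsetSum fun l (_ : l ∈ Finset.univ) => hi2 _ l,
    intervalIntegral.integral_const_mul, hφ.mean_zero _ (hmem _),
    hφ.orthonormal _ (hmem _) _ (hmem _)]
  simp [Fin.val_inj, sq]

/-! ### Continuous mapping off a null set -/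

/-- The continuous mapping theorem for a map that is continuous on an open set of full measure. -/
lemma tendsto_map_of_continuousOn {ι E F : Type*} [TopologicalSpace E] [MeasurableSpace E]
    [OpensMeasurableSpace E] [PseudoMetricSpace F] [MeasurableSpace F]
    [BorelSpace F] {L : Filter ι} [L.IsCountablyGenerated]
    {μs : ι → ProbabilityMeasure E} {μ : ProbabilityMeasure E} [HasOuterApproxClosed E]
    (hμ : Tendsto μs L (𝓝 μ)) {f : E → F} (hf : Measurable f) {U : Set E} (hU : IsOpen U)
    (hfU : ContinuousOn f U) (hμU : (μ : Measure E) Uᶜ = 0) :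
    Tendsto (fun i => (μs i).map hf.aemeasurable) L (𝓝 (μ.map hf.aemeasurable)) := by
  -- Portmanteau with open sets: the preimage of G need not be open, but its part inside U is, and
  -- it has the same limit measure.
  refine tendsto_of_forall_isOpen_le_liminf' fun G hG => ?_
  have hopen : IsOpen (U ∩ f ⁻¹' G) := hfU.isOpen_inter_preimage hU hG
  have hle := ProbabilityMeasure.le_liminf_measure_open_of_tendsto hμ hopen
  simp only [ProbabilityMeasure.toMeasure_map, Measure.map_apply hf hG.measurableSet]
  have hmeas : (μ : Measure E) (f ⁻¹' G) = (μ : Measure E) (U ∩ f ⁻¹' G) := by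
    refine measure_congr ?_
    have hae : ∀ᵐ x ∂(μ : Measure E), x ∈ U := measure_eq_zero_iff_ae_notMem.1 hμU |>.mono
      fun x hx => not_not.1 hx
    filter_upwards [hae] with x hx
    exact propext ⟨fun h => ⟨hx, h⟩, fun h => h.2⟩
  rw [hmeas]
  exact hle.trans (liminf_le_liminf (Eventually.of_forall fun i =>
    measure_mono Set.inter_subset_right))

/-! ### Student's t-distribution as the law of a ratio -/

/-- The ratio `x_0 / √(∑_{i ≥ 1} x_i² / n)`. -/
noncomputable def tRatio {n : ℕ} (x : Fin (n + 1) → ℝ) : ℝ :=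
  x 0 / √((∑ i : Fin n, x i.succ ^ 2) / n)

lemma measurable_tRatio {n : ℕ} : Measurable (tRatio (n := n)) := by
  unfold tRatio; fun_prop

lemma continuousOn_tRatio {n : ℕ} (hn : 0 < n) :
    ContinuousOn (tRatio (n := n)) {x | 0 < ∑ i : Fin n, x i.succ ^ 2} := by
  unfold tRatio
  refine ContinuousOn.div (by fun_prop) (by fun_prop) fun x hx => ?_
  have : (0 : ℝ) < n := by exact_mod_cast hn
  exact (Real.sqrt_pos.2 (div_pos hx this)).ne'

/-- This is how the unknown common long-run variance drops out of the limit. -/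
lemma tRatio_const_mul {n : ℕ} {c : ℝ} (hc : 0 < c) (x : Fin (n + 1) → ℝ) :
    tRatio (fun i => c * x i) = tRatio x := by
  unfold tRatio
  simp_rw [mul_pow, ← Finset.mul_sum]
  rw [mul_div_assoc (c ^ 2), Real.sqrt_mul (sq_nonneg c), Real.sqrt_sq hc.le,
    mul_div_mul_left _ _ hc.ne']

lemma studentT_eq_map_tRatio (n : ℕ) :
    (Measure.pi fun _ : Fin (n + 1) => gaussianReal 0 1).map tRatio = studentT n := by
  have hpi := measurePreserving_piFinSuccAbove (fun _ : Fin (n + 1) => gaussianReal 0 1) 0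
  have hcs : Measurable fun x : Fin n → ℝ => ∑ i, x i ^ 2 := by fun_prop
  have hq : Measurable fun p : ℝ × ℝ => p.1 / √(p.2 / n) := by fun_prop
  have hprod := Measure.map_prod_map (gaussianReal 0 1)
    (Measure.pi fun _ : Fin n => gaussianReal 0 1) measurable_id hcs
  rw [Measure.map_id] at hprod
  rw [studentT, chiSquared, hprod, Measure.map_map hq (measurable_id.prodMap hcs), ← hpi.map_eq,
    Measure.map_map (hq.comp (measurable_id.prodMap hcs)) (MeasurableEquiv.measurable _)]
  congr 1

lemma map_tRatio_pi_gaussianReal {v : ℝ≥0} (hv : 0 < v) (n : ℕ) :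
    (Measure.pi fun _ : Fin (n + 1) => gaussianReal 0 v).map tRatio = studentT n := by
  have hc : (0 : ℝ) < √(v : ℝ) := Real.sqrt_pos.2 hv
  have hg : (gaussianReal 0 1).map (√(v : ℝ) * ·) = gaussianReal 0 v := by
    rw [gaussianReal_map_const_mul, mul_zero, mul_one]
    congr 1
    ext
    exact Real.sq_sqrt v.2
  have hpi := Measure.pi_map_pi (μ := fun _ : Fin (n + 1) => gaussianReal 0 1)
    (f := fun _ x => √(v : ℝ) * x) fun _ => by fun_prop
  simp only [hg] at hpi
  rw [← hpi, Measure.map_map measurable_tRatio (by fun_prop), ← studentT_eq_map_tRatio]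
  congr 1
  funext x
  exact tRatio_const_mul hc x

/-- A vanishing sum of squares forces one fixed coordinate to be 0, and a nondegenerate Gaussian has
no atoms. -/
lemma pi_gaussianReal_sum_sq_eq_zero {v : ℝ≥0} (hv : v ≠ 0) {n : ℕ} (hn : 0 < n) :
    (Measure.pi fun _ : Fin (n + 1) => gaussianReal 0 v)
      {x | 0 < ∑ i : Fin n, x i.succ ^ 2}ᶜ = 0 := by
  have := nullSingletonClass_gaussianReal (μ := 0) hv
  refine measure_mono_null (fun x hx => ?_) (Measure.pi_hyperplane _ (Fin.succ ⟨0, hn⟩) 0)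
  rw [Set.mem_compl_iff, Set.mem_ofPred_eq, not_lt] at hx
  have h0 : ∑ i : Fin n, x i.succ ^ 2 = 0 := hx.antisymm (Finset.sum_nonneg fun _ _ => sq_nonneg _)
  rw [Finset.sum_eq_zero_iff_of_nonneg fun _ _ => sq_nonneg _] at h0
  exact Set.mem_ofPred.2 (pow_eq_zero_iff two_ne_zero |>.1 (h0 ⟨0, hn⟩ (Finset.mem_univ _)))

/-! ### The t-statistic in terms of the two score vectors -/

/-- The weighted difference of the leading scores, followed by the demeaned remaining scores of the
two samples. -/
noncomputable def jointScore {K₁ K₂ : ℕ} (a b : ℝ) (c₁ : Fin K₁ → ℝ) (c₂ : Fin K₂ → ℝ)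
    (x : Fin (K₁ + 1) → ℝ) (y : Fin (K₂ + 1) → ℝ) : Fin (K₁ + K₂ + 1) → ℝ :=
  Fin.cons (a * x 0 - b * y 0)
    (Fin.append (fun l => x l.succ - c₁ l * x 0) fun l => y l.succ - c₂ l * y 0)

/-- The coefficients of the first score vector in a linear combination of the joint score. -/
noncomputable def leftCoeff {K₁ K₂ : ℕ} (a : ℝ) (c : Fin K₁ → ℝ) (s : Fin (K₁ + K₂ + 1) → ℝ) :
    Fin (K₁ + 1) → ℝ :=
  Fin.cons (a * s 0 - ∑ l, s (Fin.castAdd K₂ l).succ * c l) fun l => s (Fin.castAdd K₂ l).succ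

/-- The coefficients of the second score vector in a linear combination of the joint score. -/
noncomputable def rightCoeff {K₁ K₂ : ℕ} (b : ℝ) (c : Fin K₂ → ℝ) (s : Fin (K₁ + K₂ + 1) → ℝ) :
    Fin (K₂ + 1) → ℝ :=
  Fin.cons (-b * s 0 - ∑ l, s (Fin.natAdd K₁ l).succ * c l) fun l => s (Fin.natAdd K₁ l).succ

section Joint

variable {K₁ K₂ : ℕ}

/-- Regrouping by sample, so that independence can be applied to the two sums. -/
lemma sum_mul_jointScore (a b : ℝ) (c₁ : Fin K₁ → ℝ) (c₂ : Fin K₂ → ℝ)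
    (x : Fin (K₁ + 1) → ℝ) (y : Fin (K₂ + 1) → ℝ) (s : Fin (K₁ + K₂ + 1) → ℝ) :
    ∑ i, s i * jointScore a b c₁ c₂ x y i
      = ∑ i, leftCoeff a c₁ s i * x i + ∑ i, rightCoeff b c₂ s i * y i := by
  simp only [Fin.sum_univ_succ (n := K₁ + K₂), Fin.sum_univ_succ (n := K₁),
    Fin.sum_univ_succ (n := K₂), Fin.sum_univ_add, jointScore, leftCoeff, rightCoeff,
    Fin.cons_zero, Fin.cons_succ, Fin.append_left, Fin.append_right, mul_sub, sub_mul,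
    Finset.sum_sub_distrib, Finset.sum_mul, ← mul_assoc]
  ring

/-- The centering constants are 0, the limit of the grid means. The result depends on (a, b) only
through a² + b² = 1, so the limit law ignores the relative sample sizes. -/
lemma sum_sq_coeff {a b : ℝ} (hab : a ^ 2 + b ^ 2 = 1) (s : Fin (K₁ + K₂ + 1) → ℝ) :
    ∑ i, leftCoeff a (0 : Fin K₁ → ℝ) s i ^ 2 + ∑ i, rightCoeff b (0 : Fin K₂ → ℝ) s i ^ 2
      = ∑ i, s i ^ 2 := by
  simp only [Fin.sum_univ_succ (n := K₁ + K₂), Fin.sum_univ_succ (n := K₁),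
    Fin.sum_univ_succ (n := K₂), Fin.sum_univ_add, leftCoeff, rightCoeff,
    Fin.cons_zero, Fin.cons_succ, Pi.zero_apply, mul_zero, Finset.sum_const_zero, sub_zero]
  linear_combination s 0 ^ 2 * hab

lemma continuous_leftCoeff (s : Fin (K₁ + K₂ + 1) → ℝ) :
    Continuous fun p : ℝ × (Fin K₁ → ℝ) => leftCoeff p.1 p.2 s := by
  refine continuous_pi fun i => ?_
  refine Fin.cases ?_ (fun l => ?_) i
  · simp only [leftCoeff, Fin.cons_zero]; fun_prop
  · simp only [leftCoeff, Fin.cons_succ]; fun_prop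

lemma continuous_rightCoeff (s : Fin (K₁ + K₂ + 1) → ℝ) :
    Continuous fun p : ℝ × (Fin K₂ → ℝ) => rightCoeff p.1 p.2 s := by
  refine continuous_pi fun i => ?_
  refine Fin.cases ?_ (fun l => ?_) i
  · simp only [rightCoeff, Fin.cons_zero]; fun_prop
  · simp only [rightCoeff, Fin.cons_succ]; fun_prop

lemma measurable_jointScore (a b : ℝ) (c₁ : Fin K₁ → ℝ) (c₂ : Fin K₂ → ℝ) :
    Measurable fun p : (Fin (K₁ + 1) → ℝ) × (Fin (K₂ + 1) → ℝ) =>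
      jointScore a b c₁ c₂ p.1 p.2 := by
  refine measurable_pi_lambda _ fun i => ?_
  refine Fin.cases ?_ (fun l => ?_) i
  · simp only [jointScore, Fin.cons_zero]; fun_prop
  · simp only [jointScore, Fin.cons_succ]
    refine Fin.addCases (fun k => ?_) (fun k => ?_) l
    · simp only [Fin.append_left]; fun_prop
    · simp only [Fin.append_right]; fun_prop

/-- The weight of a sample of size `m` relative to another one of size `n`. -/
noncomputable def sampleWeight (m n : ℕ) : ℝ := (1 / √(m : ℝ)) / √(1 / (m : ℝ) + 1 / (n : ℝ))

/-- Compactness for subsequence extraction; it also holds at size 0, where 1/0 = 0. -/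
lemma sampleWeight_mem_Icc (m n : ℕ) : sampleWeight m n ∈ Set.Icc (0 : ℝ) 1 := by
  refine ⟨by unfold sampleWeight; positivity, div_le_one_of_le₀ ?_ (Real.sqrt_nonneg _)⟩
  rw [← Real.sqrt_one, ← Real.sqrt_div zero_le_one, Real.sqrt_one]
  exact Real.sqrt_le_sqrt (le_add_of_nonneg_right (by positivity))

lemma sampleWeight_sq_add_sq {m n : ℕ} (hm : 0 < m) (hn : 0 < n) :
    sampleWeight m n ^ 2 + sampleWeight n m ^ 2 = 1 := by
  have hm' : (0 : ℝ) < m := by exact_mod_cast hm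
  have hn' : (0 : ℝ) < n := by exact_mod_cast hn
  simp only [sampleWeight, div_pow, one_pow]
  rw [Real.sq_sqrt hm'.le, Real.sq_sqrt hn'.le, Real.sq_sqrt (by positivity),
    Real.sq_sqrt (by positivity), add_comm (1 / (n : ℝ)), ← add_div, div_self (by positivity)]

/-- The average of each basis function over the regular grid of size `T`. -/
noncomputable def gridMean (φ : ℕ → ℝ → ℝ) (K T : ℕ) : Fin K → ℝ := fun l =>
  (1 / (T : ℝ)) * ∑ t ∈ Finset.Icc 1 T, φ (l + 1) ((t : ℝ) / T)

lemma IsBasisFamily.tendsto_gridMean {φ : ℕ → ℝ → ℝ} {M : ℕ} (hφ : IsBasisFamily φ M) {K : ℕ}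
    (hK : K ≤ M) : Tendsto (gridMean φ K) atTop (𝓝 0) := by
  refine tendsto_pi_nhds.2 fun l => ?_
  have hmem : (l : ℕ) + 1 ∈ Finset.Icc 1 M := Finset.mem_Icc.2 ⟨by omega, by have := l.2; omega⟩
  have := (HasContDerivOn.of_contDiffOn (hφ.contDiffOn _ hmem)).tendsto_riemannSum
  rwa [hφ.mean_zero _ hmem] at this

lemma mul_seriesLRV (φ : ℕ → ℝ → ℝ) {K : ℕ} (hK : 1 ≤ K) (y : ℕ → ℝ) (T : ℕ) :
    K * seriesLRV φ K y T = ∑ l : Fin K, projCoeff (φ (l + 1)) y T ^ 2 := by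
  have : (K : ℝ) ≠ 0 := by exact_mod_cast (by omega : K ≠ 0)
  rw [seriesLRV, ← mul_assoc, mul_one_div_cancel this, one_mul, sum_Icc_one_eq_sum_range,
    Fin.sum_univ_eq_sum_range fun k => projCoeff (φ (k + 1)) y T ^ 2]

/-- The joint score vector of two samples. -/
noncomputable def sampleJointScore (φ : ℕ → ℝ → ℝ) (K₁ K₂ : ℕ) (v₁ v₂ : ℕ → ℝ) (T : ℕ × ℕ) :
    Fin (K₁ + K₂ + 1) → ℝ :=
  jointScore (sampleWeight T.1 T.2) (sampleWeight T.2 T.1) (gridMean φ K₁ T.1) (gridMean φ K₂ T.2)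
    (scoreVector (fun l : Fin K₁ => φ (l + 1)) T.1 v₁)
    (scoreVector (fun l : Fin K₂ => φ (l + 1)) T.2 v₂)

/-- The common mean cancels everywhere. The factor √(1/T₁ + 1/T₂) is absorbed into the leading
coordinate, and each K_j Ω̂_j is a plain sum of squared coordinates. -/
lemma tHAR_const_add (φ : ℕ → ℝ → ℝ) (hK₁ : 1 ≤ K₁) (hK₂ : 1 ≤ K₂) (m : ℝ) (v₁ v₂ : ℕ → ℝ)
    {T : ℕ × ℕ} (hT₁ : 0 < T.1) (hT₂ : 0 < T.2) :
    tHAR φ K₁ K₂ (fun t => m + v₁ t) (fun t => m + v₂ t) T.1 T.2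
      = tRatio (sampleJointScore φ K₁ K₂ v₁ v₂ T) := by
  have hp₁ : ∀ l : Fin K₁, projCoeff (φ (l + 1)) (fun t => m + v₁ t) T.1
      = sampleJointScore φ K₁ K₂ v₁ v₂ T (Fin.castAdd K₂ l).succ := fun l => by
    rw [projCoeff_const_add _ m v₁ hT₁,
      projCoeff_eq_scoreVector (φ := fun l : Fin K₁ => φ (l + 1)) l]
    simp [sampleJointScore, jointScore, gridMean]
  have hp₂ : ∀ l : Fin K₂, projCoeff (φ (l + 1)) (fun t => m + v₂ t) T.2
      = sampleJointScore φ K₁ K₂ v₁ v₂ T (Fin.natAdd K₁ l).succ := fun l => by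
    rw [projCoeff_const_add _ m v₂ hT₂,
      projCoeff_eq_scoreVector (φ := fun l : Fin K₂ => φ (l + 1)) l]
    simp [sampleJointScore, jointScore, gridMean]
  have h0 : sampleJointScore φ K₁ K₂ v₁ v₂ T 0
      = (sampleMean v₁ T.1 - sampleMean v₂ T.2) / √(1 / (T.1 : ℝ) + 1 / (T.2 : ℝ)) := by
    rw [sampleMean_eq_scoreVector (fun l : Fin K₁ => φ (l + 1)) T.1 v₁,
      sampleMean_eq_scoreVector (fun l : Fin K₂ => φ (l + 1)) T.2 v₂]
    simp only [sampleJointScore, jointScore, Fin.cons_zero, sampleWeight,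
      add_comm (1 / (T.2 : ℝ))]
    ring
  rw [tHAR, pooledScale, mul_seriesLRV φ hK₁, mul_seriesLRV φ hK₂, sampleMean_const_add m v₁ hT₁,
    sampleMean_const_add m v₂ hT₂, add_sub_add_left_eq_sub, tRatio, h0, Fin.sum_univ_add, div_div,
    mul_comm]
  simp only [hp₁, hp₂, Nat.cast_add]

end Joint

/-- Cramér–Wold: the vector characteristic function at s is the scalar one of the combination with
weights s, taken at 1. -/
lemma charFun_map_toLp {Ω ι : Type*} [MeasurableSpace Ω] [Fintype ι] {P : Measure Ω}
    {Q : Ω → ι → ℝ} (hQ : AEMeasurable Q P) (s : EuclideanSpace ℝ ι) :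
    charFun (P.map fun ω => WithLp.toLp 2 (Q ω)) s
      = charFun (P.map fun ω => ∑ i, s i * Q ω i) 1 := by
  have h1 : AEMeasurable (fun ω => WithLp.toLp 2 (Q ω)) P :=
    (WithLp.measurable_toLp 2 _).comp_aemeasurable hQ
  have h2 : AEMeasurable (fun ω => ∑ i, s i * Q ω i) P := by fun_prop
  rw [charFun_apply, charFun_apply_real, integral_map h1 (by fun_prop),
    integral_map h2 (by fun_prop)]
  simp [PiLp.inner_apply]

lemma charFun_map_toLp_pi_gaussianReal {ι : Type*} [Fintype ι] (v : ℝ≥0)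
    (s : EuclideanSpace ℝ ι) :
    charFun ((Measure.pi fun _ : ι => gaussianReal 0 v).map (WithLp.toLp 2)) s
      = Complex.exp (-((v * ∑ i, s i ^ 2 : ℝ) : ℂ) / 2) := by
  rw [charFun_pi]
  simp_rw [charFun_gaussianReal]
  rw [← Complex.exp_sum]
  congr 1
  rw [Finset.mul_sum]
  push_cast
  rw [neg_div, Finset.sum_div, ← Finset.sum_neg_distrib]
  refine Finset.sum_congr rfl fun i _ => ?_
  simp

section Main

variable {Ω Ω' : Type*} [MeasurableSpace Ω] [MeasurableSpace Ω']
  {P : Measure Ω} {P' : Measure Ω'}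
  {u : Fin 2 → ℕ → Ω → ℝ} {φ : ℕ → ℝ → ℝ} {K₁ K₂ : ℕ}

lemma aemeasurable_sampleJointScore (hu : ∀ j t, 1 ≤ t → AEMeasurable (u j t) P) (T : ℕ × ℕ) :
    AEMeasurable (fun ω => sampleJointScore φ K₁ K₂ (fun t => u 0 t ω) (fun t => u 1 t ω) T) P :=
  (measurable_jointScore _ _ _ _).comp_aemeasurable
    ((aemeasurable_scoreVector (hu 0) T.1).prodMk (aemeasurable_scoreVector (hu 1) T.2))

/-- The characteristic function of the joint score factors over the two independent samples. -/
lemma charFun_sampleJointScore [IsProbabilityMeasure P]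
    (hu : ∀ j t, 1 ≤ t → AEMeasurable (u j t) P)
    (hindep : IndepFun (fun ω (t : ℕ) => u 0 (t + 1) ω) (fun ω (t : ℕ) => u 1 (t + 1) ω) P)
    (T : ℕ × ℕ) (s : Fin (K₁ + K₂ + 1) → ℝ) :
    charFun (P.map fun ω => ∑ i, s i *
        sampleJointScore φ K₁ K₂ (fun t => u 0 t ω) (fun t => u 1 t ω) T i) 1
      = charFun (P.map fun ω => ∑ i, leftCoeff (sampleWeight T.1 T.2) (gridMean φ K₁ T.1) s i *
            scoreVector (fun l : Fin K₁ => φ (l + 1)) T.1 (fun t => u 0 t ω) i) 1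
        * charFun (P.map fun ω => ∑ i, rightCoeff (sampleWeight T.2 T.1) (gridMean φ K₂ T.2) s i *
            scoreVector (fun l : Fin K₂ => φ (l + 1)) T.2 (fun t => u 1 t ω) i) 1 := by
  simp only [sampleJointScore, sum_mul_jointScore]
  have hm : ∀ {K : ℕ} (j : Fin 2) (n : ℕ) (a : Fin (K + 1) → ℝ), AEMeasurable (fun ω => ∑ i, a i *
      scoreVector (fun l : Fin K => φ (l + 1)) n (fun t => u j t ω) i) P := fun {K} j n a => by
    have := aemeasurable_scoreVector (φ := fun l : Fin K => φ (l + 1)) (hu j) n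
    fun_prop
  have hlin : ∀ {K : ℕ} (n : ℕ) (a : Fin (K + 1) → ℝ), Measurable fun w : ℕ → ℝ => ∑ i, a i *
      scoreVector (fun l : Fin K => φ (l + 1)) n (fun t => w (t - 1)) i := fun {K} n a => by
    have := measurable_scoreVector_shift (φ := fun l : Fin K => φ (l + 1)) n
    fun_prop
  have hX := hindep.comp (hlin T.1 (leftCoeff (sampleWeight T.1 T.2) (gridMean φ K₁ T.1) s))
    (hlin T.2 (rightCoeff (sampleWeight T.2 T.1) (gridMean φ K₂ T.2) s))
  have hcomp : ∀ {K : ℕ} (j : Fin 2) (n : ℕ) (a : Fin (K + 1) → ℝ),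
      (fun w : ℕ → ℝ => ∑ i, a i *
        scoreVector (fun l : Fin K => φ (l + 1)) n (fun t => w (t - 1)) i) ∘
          (fun ω (t : ℕ) => u j (t + 1) ω)
      = fun ω => ∑ i, a i * scoreVector (fun l : Fin K => φ (l + 1)) n (fun t => u j t ω) i :=
    fun j n a => by
      funext ω
      exact Finset.sum_congr rfl fun i _ => by rw [scoreVector_eq_shift n fun t => u j t ω]
  rw [hcomp, hcomp] at hX
  exact congrFun (hX.charFun_map_fun_add_eq_mul (hm _ _ _) (hm _ _ _)) 1

/-- The joint score converges weakly to a spherical Gaussian vector, whatever the relative growth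
rates of the two sample sizes. -/
lemma tendsto_law_sampleJointScore [IsProbabilityMeasure P] [IsProbabilityMeasure P']
    {lrv : Fin 2 → ℝ} {W : Fin 2 → ℝ≥0 → Ω' → ℝ}
    (hu : ∀ j t, 1 ≤ t → AEMeasurable (u j t) P)
    (hindep : IndepFun (fun ω (t : ℕ) => u 0 (t + 1) ω) (fun ω (t : ℕ) => u 1 (t + 1) ω) P)
    (hφ : IsBasisFamily φ (max K₁ K₂)) (hW : IsStandardBrownian₂ W P')
    (hF : FunctionalCLT P P' u lrv W) {v : ℝ≥0} (hv : ∀ j, lrv j = v)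
    (μs : ℕ × ℕ → ProbabilityMeasure (EuclideanSpace ℝ (Fin (K₁ + K₂ + 1))))
    (hμs : ∀ T, (μs T : Measure (EuclideanSpace ℝ (Fin (K₁ + K₂ + 1)))) =
      P.map fun ω => WithLp.toLp 2
        (sampleJointScore φ K₁ K₂ (fun t => u 0 t ω) (fun t => u 1 t ω) T))
    (μ : ProbabilityMeasure (EuclideanSpace ℝ (Fin (K₁ + K₂ + 1))))
    (hμ : (μ : Measure (EuclideanSpace ℝ (Fin (K₁ + K₂ + 1)))) =
      (Measure.pi fun _ => gaussianReal 0 v).map (WithLp.toLp 2)) :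
    Tendsto μs (atTop ×ˢ atTop) (𝓝 μ) := by
  -- Every sequence of sample sizes has a subsequence along which the two weights converge, and the
  -- limit law is the same for each, so no rate condition enters.
  refine tendsto_of_subseq_tendsto fun T hT => ?_
  obtain ⟨⟨a, b⟩, -, ms, hms, hab⟩ := (isCompact_Icc.prod isCompact_Icc).tendsto_subseq
    (x := fun n => (sampleWeight (T n).1 (T n).2, sampleWeight (T n).2 (T n).1))
    (s := Set.Icc (0 : ℝ) 1 ×ˢ Set.Icc (0 : ℝ) 1)
    fun n => ⟨sampleWeight_mem_Icc _ _, sampleWeight_mem_Icc _ _⟩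
  have hT₁ : Tendsto (fun n => (T (ms n)).1) atTop atTop :=
    (tendsto_fst.comp hT).comp hms.tendsto_atTop
  have hT₂ : Tendsto (fun n => (T (ms n)).2) atTop atTop :=
    (tendsto_snd.comp hT).comp hms.tendsto_atTop
  have ha : Tendsto (fun n => sampleWeight (T (ms n)).1 (T (ms n)).2) atTop (𝓝 a) :=
    (continuous_fst.tendsto _).comp hab
  have hb : Tendsto (fun n => sampleWeight (T (ms n)).2 (T (ms n)).1) atTop (𝓝 b) :=
    (continuous_snd.tendsto _).comp hab
  have hab1 : a ^ 2 + b ^ 2 = 1 := by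
    refine tendsto_nhds_unique ((ha.pow 2).add (hb.pow 2)) (tendsto_const_nhds.congr' ?_)
    filter_upwards [hT₁.eventually_gt_atTop 0, hT₂.eventually_gt_atTop 0] with n h1 h2
    exact (sampleWeight_sq_add_sq h1 h2).symm
  refine ⟨ms, ProbabilityMeasure.tendsto_iff_tendsto_charFun.2 fun s => ?_⟩
  have hderiv : ∀ {K : ℕ}, K ≤ max K₁ K₂ → ∀ l : Fin K, HasContDerivOn (φ (l + 1))
      (derivWithin (φ (l + 1)) (Set.Icc 0 1)) := fun hK l =>
    HasContDerivOn.of_contDiffOn (hφ.contDiffOn _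
      (Finset.mem_Icc.2 ⟨by omega, by have := l.2; omega⟩))
  -- The coefficients converge to their values at (a, 0), because the grid means vanish in the
  -- limit.
  have hleft := tendsto_charFun_scoreVector hW hF 0 (by rw [hv]; exact v.2)
    (hderiv (le_max_left K₁ K₂)) (hφ.integral_sq (le_max_left K₁ K₂)) hT₁
    (((continuous_leftCoeff (K₂ := K₂) s).tendsto (a, 0)).comp
      (ha.prodMk_nhds ((hφ.tendsto_gridMean (le_max_left K₁ K₂)).comp hT₁)))
  have hright := tendsto_charFun_scoreVector hW hF 1 (by rw [hv]; exact v.2)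
    (hderiv (le_max_right K₁ K₂)) (hφ.integral_sq (le_max_right K₁ K₂)) hT₂
    (((continuous_rightCoeff (K₁ := K₁) s).tendsto (b, 0)).comp
      (hb.prodMk_nhds ((hφ.tendsto_gridMean (le_max_right K₁ K₂)).comp hT₂)))
  have hprod := hleft.mul hright
  -- The equal long-run variances allow the two exponents to merge into v · ∑ s_i².
  rw [hv, hv, ← Complex.exp_add, ← add_div, ← neg_add, ← Complex.ofReal_add, ← mul_add,
    sum_sq_coeff hab1, ← charFun_map_toLp_pi_gaussianReal, ← hμ] at hprod
  refine hprod.congr fun n => ?_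
  rw [hμs, charFun_map_toLp (aemeasurable_sampleJointScore hu _),
    charFun_sampleJointScore hu hindep]
  rfl

lemma aemeasurable_tHAR {Y : Fin 2 → ℕ → Ω → ℝ} (hY : ∀ j t, 1 ≤ t → AEMeasurable (Y j t) P)
    (T : ℕ × ℕ) :
    AEMeasurable (fun ω => tHAR φ K₁ K₂ (fun t => Y 0 t ω) (fun t => Y 1 t ω) T.1 T.2) P := by
  have hscore : ∀ j n (f : Fin 1 → ℝ → ℝ),
      AEMeasurable (fun ω => scoreVector f n fun t => Y j t ω) P := fun j n f =>
    aemeasurable_scoreVector (hY j) n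
  have hmean : ∀ j n, AEMeasurable (fun ω => sampleMean (fun t => Y j t ω) n) P := fun j n => by
    -- A one-element family is enough: the leading score does not depend on the family.
    simp_rw [sampleMean_eq_scoreVector (fun _ : Fin 1 => φ 1)]
    have := hscore j n fun _ => φ 1
    fun_prop
  have hproj : ∀ j n f, AEMeasurable (fun ω => projCoeff f (fun t => Y j t ω) n) P :=
    fun j n f => by
      simp_rw [projCoeff_eq_scoreVector (φ := fun _ : Fin 1 => f) 0]
      have := hscore j n fun _ => f
      fun_prop
  unfold tHAR pooledScale seriesLRV
  fun_prop

end Main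

end SeriesHAR

/-! ### Conclusion: from the Gaussian limit of the joint score to Student's law -/

theorem theorem1
    {Ω Ω' : Type*} [MeasurableSpace Ω] [MeasurableSpace Ω']
    (P : Measure Ω) [IsProbabilityMeasure P] (P' : Measure Ω') [IsProbabilityMeasure P']
    (Y u : Fin 2 → ℕ → Ω → ℝ) (μ σ lrv : Fin 2 → ℝ)
    (W : Fin 2 → ℝ≥0 → Ω' → ℝ)
    (φ : ℕ → ℝ → ℝ) (K₁ K₂ : ℕ) (hK₁ : 1 ≤ K₁) (hK₂ : 1 ≤ K₂)
    (hmodel : TwoSampleModel P Y u μ σ)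
    (hφ : IsBasisFamily φ (max K₁ K₂))
    (hW : IsStandardBrownian₂ W P')
    (hFCLT : FunctionalCLT P P' u lrv W)
    (hlrv_pos : ∀ j, 0 < lrv j) (hlrv : lrv 0 = lrv 1)
    (hH₀ : μ 0 = μ 1) :
    TendstoInDistribution
      (fun (T : ℕ × ℕ) (ω : Ω) =>
        tHAR φ K₁ K₂ (fun t => Y 0 t ω) (fun t => Y 1 t ω) T.1 T.2)
      (atTop ×ˢ atTop) id (fun _ => P) (studentT (K₁ + K₂)) := by
  have hu : ∀ j t, 1 ≤ t → AEMeasurable (u j t) P := fun j t ht =>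
    (hmodel.memLp j t ht).aestronglyMeasurable.aemeasurable
  have hY : ∀ j t, 1 ≤ t → AEMeasurable (Y j t) P := fun j t ht => by
    simpa only [← hmodel.obs] using (hu j t ht).const_add (μ j)
  refine ⟨aemeasurable_tHAR hY, aemeasurable_id, ?_⟩
  set v : ℝ≥0 := ⟨lrv 0, (hlrv_pos 0).le⟩
  have hv0 : 0 < v := hlrv_pos 0
  have hv : ∀ j, lrv j = v := fun j => by
    fin_cases j
    · rfl
    · exact hlrv.symm
  have hQ := fun T => (WithLp.measurable_toLp 2 (Fin (K₁ + K₂ + 1) → ℝ)).comp_aemeasurable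
    (aemeasurable_sampleJointScore (φ := φ) (K₁ := K₁) (K₂ := K₂) hu T)
  have htoLp : Measurable (WithLp.toLp 2 : (Fin (K₁ + K₂ + 1) → ℝ) → _) :=
    WithLp.measurable_toLp 2 _
  have hweak := tendsto_law_sampleJointScore hu hmodel.indep hφ hW hFCLT hv
    (fun T => ⟨_, Measure.isProbabilityMeasure_map (hQ T)⟩) (fun T => rfl)
    ⟨(Measure.pi fun _ => gaussianReal 0 v).map (WithLp.toLp 2),
      Measure.isProbabilityMeasure_map htoLp.aemeasurable⟩ rfl
  have hofLp : Continuous (WithLp.ofLp : EuclideanSpace ℝ (Fin (K₁ + K₂ + 1)) → _) :=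
    PiLp.continuous_ofLp 2 _
  have hn : 0 < K₁ + K₂ := by omega
  have hU : IsOpen {x : Fin (K₁ + K₂ + 1) → ℝ | 0 < ∑ i : Fin (K₁ + K₂), x i.succ ^ 2} :=
    isOpen_lt continuous_const (by fun_prop)
  -- The ratio is used as continuous only where its denominator is positive, an open set of full
  -- limit measure because K₁ + K₂ > 0.
  have hratio := tendsto_map_of_continuousOn hweak (measurable_tRatio.comp hofLp.measurable)
    (hU.preimage hofLp) ((continuousOn_tRatio hn).comp hofLp.continuousOn fun _ h => h) (by
      rw [ProbabilityMeasure.coe_mk, Measure.map_apply htoLp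
        (hU.preimage hofLp).measurableSet.compl]
      exact pi_gaussianReal_sum_sq_eq_zero hv0.ne' hn)
  have hlim : ∀ (ν : ProbabilityMeasure ℝ), (ν : Measure ℝ) = studentT (K₁ + K₂) →
      ProbabilityMeasure.map ⟨(Measure.pi fun _ => gaussianReal 0 v).map (WithLp.toLp 2),
        Measure.isProbabilityMeasure_map htoLp.aemeasurable⟩
        (measurable_tRatio.comp hofLp.measurable).aemeasurable = ν := fun ν hν => by
    refine Subtype.ext ?_
    rw [← map_tRatio_pi_gaussianReal hv0 (K₁ + K₂)] at hν
    refine Eq.trans ?_ hν.symm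
    exact Measure.map_map (measurable_tRatio.comp hofLp.measurable) htoLp
  rw [hlim ⟨(studentT (K₁ + K₂)).map id, Measure.isProbabilityMeasure_map aemeasurable_id⟩
    Measure.map_id] at hratio
  refine hratio.congr' ?_
  -- For positive sample sizes the statistic equals the ratio exactly, so the laws coincide
  -- eventually.
  filter_upwards [prod_mem_prod (Ioi_mem_atTop 0) (Ioi_mem_atTop 0)] with T hT
  refine Subtype.ext ?_
  refine (AEMeasurable.map_map_of_aemeasurable
    (measurable_tRatio.comp hofLp.measurable).aemeasurable (hQ T)).trans ?_
  refine congrArg (fun f => P.map f) (funext fun ω => ?_)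
  simp only [hmodel.obs, ← hH₀, Function.comp_apply]
  exact (tHAR_const_add φ hK₁ hK₂ (μ 0) _ _ hT.1 hT.2).symm
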